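/- Conventions. A real algebraic variety is a ringed space, with structure sheaf of $\mathbb{R}$-algebras of $\mathbb{R}$-valued functions, which is isomorphic to a Zariski locally closed subset of $\mathbb{P}^n(\mathbb{R})$ for some $n$, endowed with the Zariski topology and the sheaf of regular functions; morphisms of such spaces are called regular maps. Continuity, homotopies and the compact-open topology refer to the Euclidean topology. Let $Y$ be a nonsingular real algebraic variety. A spray $(E,p,s)$ for $Y$ consists of an algebraic vector bundle $p\colon E\to Y$ and a regular map $s\colon E\to Y$ with $s(0_y)=y$ for all $y\in Y$, where $0_y$ is the zero vector of the fiber $E_y=p^{-1}(y)$. The spray is dominating if for every $y\in Y$ the regular map $E_y\to Y$, $v\mapsto s(v)$, is a submersion at $0_y$. The variety $Y$ is malleable if it admits a dominating spray. Theorem 1.14. Let $Y$ be a malleable nonsingular real algebraic variety. Let $X$ be a real algebraic variety (possibly singular), $f\colon D\to Y$ a continuous map defined on an arbitrary subset $D$ of $X$, and $A$ a Zariski closed subvariety of $X$. Assume that there is a regular map $f_0\colon X\to Y$ such that $f_0|_{D\cap A}=f|_{D\cap A}$ and $f_0|_D$ is homotopic to $f$ relative to $D\cap A$. Then $f$ can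 be approximated in the compact-open topology by regular maps from $X$ to $Y$ whose restrictions to $A$ are equal to $f_0|_A$; that is, for every open neighborhood $\mathcal{U}$ of $f$ in the space $\mathcal{C}(D,Y)$ of continuous maps from $D$ to $Y$, endowed with the compact-open topology, there exists a regular map $g\colon X\to Y$ with $g|_D\in\mathcal{U}$ and $g|_A=f_0|_A$. -/

import Mathlib

open scoped Topology

universe u v

/-! ### Ringed spaces of real-valued functions -/

/-- A ringed space whose structure sheaf `𝒪` is a sheaf of `ℝ`-algebras of `ℝ`-valued functions.

A sheaf of functions is recorded through its germs: `regularAt x` is the algebra of all functions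
`f : X → ℝ` which on some open neighbourhood of `x` coincide with a section of `𝒪`.  The sections
of `𝒪` over an open set `U` are then the functions that belong to `regularAt x` for all `x ∈ U`
(see `sections`), two such functions being identified when they agree on `U`. -/
structure RingedFunctionSpace (X : Type u) where
  /-- the topology of the ringed space (for varieties: the Zariski topology) -/
  zariski : TopologicalSpace X
  /-- the functions which are regular in a neighbourhood of the given point -/
  regularAt : X → Subalgebra ℝ (X → ℝ)
  /-- membership in `regularAt x` depends only on the germ at `x` -/
  regularAt_congr : ∀ (x : X) (f g : X → ℝ), f ∈ regularAt x →
    (∀ᶠ z in @nhds X zariski x, g z = f z) → g ∈ regularAt x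
  /-- a function which is regular near `x` is regular near all points close to `x` -/
  regularAt_eventually : ∀ (x : X) (f : X → ℝ), f ∈ regularAt x →
    ∀ᶠ z in @nhds X zariski x, f ∈ regularAt z

namespace RingedFunctionSpace

variable {X : Type u} {Y : Type v}

/-- The functions whose restriction to `U` is a section of the structure sheaf over `U`. -/
def sections (𝒳 : RingedFunctionSpace X) (U : Set X) : Subalgebra ℝ (X → ℝ) :=
  ⨅ x ∈ U, 𝒳.regularAt x

/-- Morphisms of ringed spaces of functions: continuous maps pulling back regular functions to
regular functions. -/
def IsMorphism (𝒳 : RingedFunctionSpace X) (𝒴 : RingedFunctionSpace Y) (f : X → Y) : Prop :=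
  Continuous[𝒳.zariski, 𝒴.zariski] f ∧
    ∀ (x : X) (φ : Y → ℝ), φ ∈ 𝒴.regularAt (f x) → φ ∘ f ∈ 𝒳.regularAt x

/-- Isomorphisms of ringed spaces of functions. -/
def IsIsomorphism (𝒳 : RingedFunctionSpace X) (𝒴 : RingedFunctionSpace Y) (e : X ≃ Y) : Prop :=
  IsMorphism 𝒳 𝒴 e ∧ IsMorphism 𝒴 𝒳 e.symm

/-- The Euclidean topology: the coarsest topology for which the Zariski open sets are open and the
regular functions on Zariski open sets are continuous with respect to the usual topology
of `ℝ`. -/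
abbrev euclidean (𝒳 : RingedFunctionSpace X) : TopologicalSpace X :=
  TopologicalSpace.generateFrom
    {S | ∃ U, IsOpen[𝒳.zariski] U ∧ ∃ f ∈ 𝒳.sections U, ∃ I : Set ℝ, IsOpen I ∧ S = U ∩ f ⁻¹' I}

theorem mem_sections {𝒳 : RingedFunctionSpace X} {U : Set X} {f : X → ℝ} :
    f ∈ 𝒳.sections U ↔ ∀ x ∈ U, f ∈ 𝒳.regularAt x := by
  simp [sections, Algebra.mem_iInf]

/-- Morphisms are continuous for the Euclidean topologies. -/
theorem IsMorphism.continuous_euclidean {𝒳 : RingedFunctionSpace X} {𝒴 : RingedFunctionSpace Y}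
    {f : X → Y} (hf : IsMorphism 𝒳 𝒴 f) : Continuous[𝒳.euclidean, 𝒴.euclidean] f := by
  let := 𝒳.euclidean
  refine continuous_generateFrom_iff.2 ?_
  rintro _ ⟨U, hU, φ, hφ, I, hI, rfl⟩
  refine TopologicalSpace.isOpen_generateFrom_of_mem
    ⟨f ⁻¹' U, @IsOpen.preimage _ _ 𝒳.zariski 𝒴.zariski _ hf.1 _ hU, φ ∘ f, ?_, I, hI, rfl⟩
  rw [mem_sections] at hφ ⊢
  exact fun x hx => hf.2 x φ (hφ (f x) hx)

/-- A subset `S` of a ringed space of functions with the induced structure: the topology is the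
subspace topology, and a function on `S` is regular at a point if near this point it is the
restriction of a regular function. -/
def sub (𝒳 : RingedFunctionSpace X) (S : Set X) : RingedFunctionSpace S where
  zariski := 𝒳.zariski.induced Subtype.val
  regularAt x :=
    { carrier := {f | ∃ g ∈ 𝒳.regularAt x.1,
        ∀ᶠ s in @nhds S (𝒳.zariski.induced Subtype.val) x, f s = g s.1}
      mul_mem' := by
        rintro f f' ⟨g, hg, h⟩ ⟨g', hg', h'⟩
        exact ⟨g * g', mul_mem hg hg', by filter_upwards [h, h'] with s h h'; simp [h, h']⟩
      add_mem' := by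
        rintro f f' ⟨g, hg, h⟩ ⟨g', hg', h'⟩
        exact ⟨g + g', add_mem hg hg', by filter_upwards [h, h'] with s h h'; simp [h, h']⟩
      algebraMap_mem' := fun r =>
        ⟨algebraMap ℝ _ r, Subalgebra.algebraMap_mem _ r, Filter.Eventually.of_forall fun _ => rfl⟩ }
  regularAt_congr := by
    rintro x f f' ⟨g, hg, h⟩ h'
    exact ⟨g, hg, by filter_upwards [h, h'] with s h h'; rw [h', h]⟩
  regularAt_eventually := by
    rintro x f ⟨g, hg, h⟩
    let := 𝒳.zariski
    have h1 : ∀ᶠ s : S in 𝓝 x, g ∈ 𝒳.regularAt s.1 :=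
      continuous_subtype_val.continuousAt.eventually (𝒳.regularAt_eventually x.1 g hg)
    have h2 : ∀ᶠ s : S in 𝓝 x, ∀ᶠ s' : S in 𝓝 s, f s' = g s'.1 := eventually_eventually_nhds.2 h
    filter_upwards [h1, h2] with s h1 h2
    exact ⟨g, h1, h2⟩

/-- The finite sums `∑ aᵢ(x) bᵢ(y)` with `aᵢ` a regular function on `U` and `bᵢ` a regular
function on `V`. -/
def boxSections (𝒳 : RingedFunctionSpace X) (𝒴 : RingedFunctionSpace Y) (U : Set X) (V : Set Y) :
    Subalgebra ℝ (X × Y → ℝ) :=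
  Algebra.adjoin ℝ ((fun a => a ∘ Prod.fst) '' (𝒳.sections U : Set (X → ℝ)) ∪
    (fun b => b ∘ Prod.snd) '' (𝒴.sections V : Set (Y → ℝ)))

theorem boxSections_mono (𝒳 : RingedFunctionSpace X) (𝒴 : RingedFunctionSpace Y)
    {U U' : Set X} {V V' : Set Y} (hU : U' ⊆ U) (hV : V' ⊆ V) :
    boxSections 𝒳 𝒴 U V ≤ boxSections 𝒳 𝒴 U' V' := by
  refine Algebra.adjoin_mono (Set.union_subset_union (Set.image_mono fun a ha => ?_)
    (Set.image_mono fun b hb => ?_))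
  · exact mem_sections.2 fun x hx => mem_sections.1 ha x (hU hx)
  · exact mem_sections.2 fun y hy => mem_sections.1 hb y (hV hy)

/-- The Zariski topology of a product, with basis the sets of all `z ∈ U × V` with `h z ≠ 0`,
where `h = ∑ aᵢ(x) bᵢ(y)` as above. -/
abbrev prodZariski (𝒳 : RingedFunctionSpace X) (𝒴 : RingedFunctionSpace Y) :
    TopologicalSpace (X × Y) :=
  TopologicalSpace.generateFrom
    {W | ∃ U V, IsOpen[𝒳.zariski] U ∧ IsOpen[𝒴.zariski] V ∧ ∃ h ∈ boxSections 𝒳 𝒴 U V,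
      W = {z | z.1 ∈ U ∧ z.2 ∈ V ∧ h z ≠ 0}}

theorem eventually_prodZariski (𝒳 : RingedFunctionSpace X) (𝒴 : RingedFunctionSpace Y)
    {U : Set X} {V : Set Y} (hU : IsOpen[𝒳.zariski] U) (hV : IsOpen[𝒴.zariski] V) {z : X × Y}
    (h1 : z.1 ∈ U) (h2 : z.2 ∈ V) :
    ∀ᶠ w in @nhds _ (prodZariski 𝒳 𝒴) z, w.1 ∈ U ∧ w.2 ∈ V := by
  let := prodZariski 𝒳 𝒴
  have ho : IsOpen {w : X × Y | w.1 ∈ U ∧ w.2 ∈ V} :=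
    TopologicalSpace.isOpen_generateFrom_of_mem ⟨U, V, hU, hV, 1, one_mem _, by ext; simp⟩
  exact ho.mem_nhds ⟨h1, h2⟩

/-- The product of two varieties: a function is regular at `z` if near `z` it is a quotient of two
functions of the form `∑ aᵢ(x) bᵢ(y)`, with regular `aᵢ`, `bᵢ`. -/
def prod (𝒳 : RingedFunctionSpace X) (𝒴 : RingedFunctionSpace Y) : RingedFunctionSpace (X × Y) where
  zariski := prodZariski 𝒳 𝒴
  regularAt z :=
    { carrier := {f | ∃ U V, IsOpen[𝒳.zariski] U ∧ IsOpen[𝒴.zariski] V ∧ z.1 ∈ U ∧ z.2 ∈ V ∧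
        ∃ g ∈ boxSections 𝒳 𝒴 U V, ∃ h ∈ boxSections 𝒳 𝒴 U V,
          ∀ᶠ w in @nhds _ (prodZariski 𝒳 𝒴) z, h w ≠ 0 ∧ f w = g w / h w}
      mul_mem' := by
        rintro f f' ⟨U, V, hU, hV, hzU, hzV, g, hg, h, hh, H⟩
          ⟨U', V', hU', hV', hzU', hzV', g', hg', h', hh', H'⟩
        have m := boxSections_mono 𝒳 𝒴 (Set.inter_subset_left (s := U) (t := U'))
          (Set.inter_subset_left (s := V) (t := V'))
        have m' := boxSections_mono 𝒳 𝒴 (Set.inter_subset_right (s := U) (t := U'))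
          (Set.inter_subset_right (s := V) (t := V'))
        refine ⟨U ∩ U', V ∩ V', @IsOpen.inter _ 𝒳.zariski _ _ hU hU',
          @IsOpen.inter _ 𝒴.zariski _ _ hV hV', ⟨hzU, hzU'⟩, ⟨hzV, hzV'⟩, g * g', mul_mem (m hg) (m' hg'),
          h * h', mul_mem (m hh) (m' hh'), ?_⟩
        filter_upwards [H, H'] with w ⟨h1, h2⟩ ⟨h1', h2'⟩
        simp [h1, h1', h2, h2', div_mul_div_comm]
      add_mem' := by
        rintro f f' ⟨U, V, hU, hV, hzU, hzV, g, hg, h, hh, H⟩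
          ⟨U', V', hU', hV', hzU', hzV', g', hg', h', hh', H'⟩
        have m := boxSections_mono 𝒳 𝒴 (Set.inter_subset_left (s := U) (t := U'))
          (Set.inter_subset_left (s := V) (t := V'))
        have m' := boxSections_mono 𝒳 𝒴 (Set.inter_subset_right (s := U) (t := U'))
          (Set.inter_subset_right (s := V) (t := V'))
        refine ⟨U ∩ U', V ∩ V', @IsOpen.inter _ 𝒳.zariski _ _ hU hU',
          @IsOpen.inter _ 𝒴.zariski _ _ hV hV', ⟨hzU, hzU'⟩, ⟨hzV, hzV'⟩, g * h' + h * g',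
          add_mem (mul_mem (m hg) (m' hh')) (mul_mem (m hh) (m' hg')),
          h * h', mul_mem (m hh) (m' hh'), ?_⟩
        filter_upwards [H, H'] with w ⟨h1, h2⟩ ⟨h1', h2'⟩
        simp [h1, h1', h2, h2', div_add_div]
      algebraMap_mem' := fun r => ⟨Set.univ, Set.univ, @isOpen_univ _ 𝒳.zariski, @isOpen_univ _ 𝒴.zariski,
        trivial, trivial, algebraMap ℝ _ r, Subalgebra.algebraMap_mem _ r, 1, one_mem _,
        Filter.Eventually.of_forall fun w => by simp⟩ }
  regularAt_congr := by
    rintro z f f' ⟨U, V, hU, hV, hzU, hzV, g, hg, h, hh, H⟩ H'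
    refine ⟨U, V, hU, hV, hzU, hzV, g, hg, h, hh, ?_⟩
    filter_upwards [H, H'] with w ⟨h1, h2⟩ h3
    exact ⟨h1, h3.trans h2⟩
  regularAt_eventually := by
    rintro z f ⟨U, V, hU, hV, hzU, hzV, g, hg, h, hh, H⟩
    filter_upwards [eventually_prodZariski 𝒳 𝒴 hU hV hzU hzV,
      (@eventually_eventually_nhds _ (prodZariski 𝒳 𝒴) _ _).2 H] with w hw hw'
    exact ⟨U, V, hU, hV, hw.1, hw.2, g, hg, h, hh, hw'⟩

end RingedFunctionSpace

/-! ### Affine and projective space over `ℝ` -/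

/-- The Zariski topology of `ℝⁿ`. -/
abbrev affineZariski (n : ℕ) : TopologicalSpace (Fin n → ℝ) :=
  TopologicalSpace.generateFrom
    {W | ∃ Q : MvPolynomial (Fin n) ℝ, W = {x | MvPolynomial.eval x Q ≠ 0}}

/-- `ℝⁿ` with the Zariski topology and the sheaf of regular functions, that is, of functions which
are locally quotients of polynomial functions. -/
def affineSpace (n : ℕ) : RingedFunctionSpace (Fin n → ℝ) where
  zariski := affineZariski n
  regularAt x :=
    { carrier := {f | ∃ P Q : MvPolynomial (Fin n) ℝ, ∀ᶠ z in @nhds _ (affineZariski n) x,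
        MvPolynomial.eval z Q ≠ 0 ∧ f z = MvPolynomial.eval z P / MvPolynomial.eval z Q}
      mul_mem' := by
        rintro f f' ⟨P, Q, h⟩ ⟨P', Q', h'⟩
        refine ⟨P * P', Q * Q', ?_⟩
        filter_upwards [h, h'] with z ⟨h1, h2⟩ ⟨h1', h2'⟩
        simp [h1, h1', h2, h2', div_mul_div_comm]
      add_mem' := by
        rintro f f' ⟨P, Q, h⟩ ⟨P', Q', h'⟩
        refine ⟨P * Q' + Q * P', Q * Q', ?_⟩
        filter_upwards [h, h'] with z ⟨h1, h2⟩ ⟨h1', h2'⟩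
        simp [h1, h1', h2, h2', div_add_div]
      algebraMap_mem' := fun r => ⟨MvPolynomial.C r, 1, Filter.Eventually.of_forall fun z => by simp⟩ }
  regularAt_congr := by
    rintro x f f' ⟨P, Q, h⟩ h'
    refine ⟨P, Q, ?_⟩
    filter_upwards [h, h'] with z ⟨h1, h2⟩ h3
    exact ⟨h1, h3.trans h2⟩
  regularAt_eventually := by
    rintro x f ⟨P, Q, h⟩
    filter_upwards [(@eventually_eventually_nhds _ (affineZariski n) _ _).2 h] with z hz
    exact ⟨P, Q, hz⟩

/-- The real projective space `ℙⁿ(ℝ)`, as a set. -/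
abbrev RealProjectiveSpace (n : ℕ) : Type := Projectivization ℝ (Fin (n + 1) → ℝ)

/-- The Zariski topology of `ℙⁿ(ℝ)`: the closed sets are the zero sets of families of homogeneous
polynomials.  The vanishing of a homogeneous polynomial at a point does not depend on the chosen
homogeneous coordinates `p.rep` of this point. -/
abbrev projectiveZariski (n : ℕ) : TopologicalSpace (RealProjectiveSpace n) :=
  TopologicalSpace.generateFrom
    {W | ∃ (d : ℕ) (Q : MvPolynomial (Fin (n + 1)) ℝ), Q.IsHomogeneous d ∧
      W = {p | MvPolynomial.eval p.rep Q ≠ 0}}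

/-- `ℙⁿ(ℝ)` with the Zariski topology and the sheaf of regular functions, that is, of functions
which are locally quotients of homogeneous polynomials of the same degree. -/
noncomputable def projectiveSpace (n : ℕ) : RingedFunctionSpace (RealProjectiveSpace n) where
  zariski := projectiveZariski n
  regularAt x :=
    { carrier := {f | ∃ (d : ℕ) (P Q : MvPolynomial (Fin (n + 1)) ℝ),
        P.IsHomogeneous d ∧ Q.IsHomogeneous d ∧ ∀ᶠ p in @nhds _ (projectiveZariski n) x,
          MvPolynomial.eval p.rep Q ≠ 0 ∧
            f p = MvPolynomial.eval p.rep P / MvPolynomial.eval p.rep Q}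
      mul_mem' := by
        rintro f f' ⟨d, P, Q, hP, hQ, h⟩ ⟨d', P', Q', hP', hQ', h'⟩
        refine ⟨d + d', P * P', Q * Q', hP.mul hP', hQ.mul hQ', ?_⟩
        filter_upwards [h, h'] with z ⟨h1, h2⟩ ⟨h1', h2'⟩
        simp [h1, h1', h2, h2', div_mul_div_comm]
      add_mem' := by
        rintro f f' ⟨d, P, Q, hP, hQ, h⟩ ⟨d', P', Q', hP', hQ', h'⟩
        refine ⟨d + d', P * Q' + Q * P', Q * Q', (hP.mul hQ').add (hQ.mul hP'), hQ.mul hQ', ?_⟩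
        filter_upwards [h, h'] with z ⟨h1, h2⟩ ⟨h1', h2'⟩
        simp [h1, h1', h2, h2', div_add_div]
      algebraMap_mem' := fun r => ⟨0, MvPolynomial.C r, 1, MvPolynomial.isHomogeneous_C _ r,
        MvPolynomial.isHomogeneous_one _ _, Filter.Eventually.of_forall fun z => by simp⟩ }
  regularAt_congr := by
    rintro x f f' ⟨d, P, Q, hP, hQ, h⟩ h'
    refine ⟨d, P, Q, hP, hQ, ?_⟩
    filter_upwards [h, h'] with z ⟨h1, h2⟩ h3
    exact ⟨h1, h3.trans h2⟩
  regularAt_eventually := by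
    rintro x f ⟨d, P, Q, hP, hQ, h⟩
    filter_upwards [(@eventually_eventually_nhds _ (projectiveZariski n) _ _).2 h] with z hz
    exact ⟨d, P, Q, hP, hQ, hz⟩

/-! ### Real algebraic varieties and regular maps -/

/-- A real algebraic variety: a ringed space with structure sheaf of `ℝ`-algebras of `ℝ`-valued
functions which is isomorphic to a Zariski locally closed subset of some `ℙⁿ(ℝ)` with the Zariski
topology and the sheaf of regular functions.  The topology of the type `X` itself (for which
continuity, homotopy, compact-open topology are understood) is the Euclidean topology. -/
class RealAlgebraicVariety (X : Type u) extends TopologicalSpace X where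
  /-- the underlying ringed space -/
  ringed : RingedFunctionSpace X
  exists_isIsomorphism : ∃ (n : ℕ) (V : Set (RealProjectiveSpace n)),
    @IsLocallyClosed _ (projectiveSpace n).zariski V ∧
      ∃ e : X ≃ V, ringed.IsIsomorphism ((projectiveSpace n).sub V) e
  topology_eq : toTopologicalSpace = ringed.euclidean

open RealAlgebraicVariety (ringed)

/-- Zariski closed subvarieties of a real algebraic variety. -/
def IsZariskiClosed {X : Type u} [RealAlgebraicVariety X] (A : Set X) : Prop :=
  IsClosed[(ringed (X := X)).zariski] A

/-- Regular maps, that is, morphisms of real algebraic varieties. -/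
structure RegularMap (X : Type u) (Y : Type v) [RealAlgebraicVariety X]
    [RealAlgebraicVariety Y] where
  toFun : X → Y
  isMorphism : (ringed (X := X)).IsMorphism (ringed (X := Y)) toFun

instance {X : Type u} {Y : Type v} [RealAlgebraicVariety X] [RealAlgebraicVariety Y] :
    CoeFun (RegularMap X Y) (fun _ => X → Y) := ⟨RegularMap.toFun⟩

theorem RegularMap.continuous {X : Type u} {Y : Type v} [RealAlgebraicVariety X]
    [RealAlgebraicVariety Y] (f : RegularMap X Y) : Continuous f := by
  have h := f.isMorphism.continuous_euclidean
  rwa [← RealAlgebraicVariety.topology_eq, ← RealAlgebraicVariety.topology_eq] at h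

/-- The restriction `f|_D` of a regular map `f : X → Y` to a subset `D` of `X`, as a continuous
map `D → Y`. -/
def RegularMap.restrict {X : Type u} {Y : Type v} [RealAlgebraicVariety X]
    [RealAlgebraicVariety Y] (f : RegularMap X Y) (D : Set X) : C(D, Y) :=
  ⟨fun x => f x, f.continuous.comp continuous_subtype_val⟩

/-- A point `y` is nonsingular if some Zariski open neighbourhood `U` of `y` is
isomorphic to `{x ∈ W | P₁(x) = ⋯ = P_c(x) = 0}`, where `W ⊆ ℝⁿ` is Zariski open and `P₁, …, P_c`
are polynomials whose gradients are linearly independent at the point corresponding to `y`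
(Jacobian criterion). -/
def IsNonsingularPoint {Y : Type v} [RealAlgebraicVariety Y] (y : Y) : Prop :=
  ∃ (U : Set Y) (hy : y ∈ U), IsOpen[(ringed (X := Y)).zariski] U ∧
    ∃ (n c : ℕ) (P : Fin c → MvPolynomial (Fin n) ℝ) (W : Set (Fin n → ℝ)),
      IsOpen[(affineSpace n).zariski] W ∧
      ∃ e : U ≃ {x : Fin n → ℝ | x ∈ W ∧ ∀ i, MvPolynomial.eval x (P i) = 0},
        ((ringed (X := Y)).sub U).IsIsomorphism ((affineSpace n).sub _) e ∧
        LinearIndependent ℝ (fun (i : Fin c) (j : Fin n) =>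
          MvPolynomial.eval (e ⟨y, hy⟩).1 (MvPolynomial.pderiv j (P i)))

/-- A real algebraic variety is nonsingular if all its points are. -/
def IsNonsingular (Y : Type v) [RealAlgebraicVariety Y] : Prop :=
  ∀ y : Y, IsNonsingularPoint y

/-! ### Tangent vectors and submersions -/

/-- The tangent vectors to `Y` at `y`: the `ℝ`-derivations at `y` of the ring of germs
of regular functions at `y`. -/
def IsTangentVector {Y : Type v} [RealAlgebraicVariety Y] (y : Y)
    (δ : (ringed (X := Y)).regularAt y →ₗ[ℝ] ℝ) : Prop :=
  ∀ φ ψ, δ (φ * ψ) = φ.1 y * δ ψ + ψ.1 y * δ φ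

/-- For a map `σ : V → Y` from a finite-dimensional real vector space with `σ 0 = y`: the
differential of `σ` at `0`, which sends `v ∈ V` to the tangent vector
`φ ↦ d/dt φ(σ(tv)) |_{t = 0}`, maps `V` onto the tangent space to `Y` at `y`. -/
def IsSubmersionAtZero {V : Type*} [AddCommGroup V] [Module ℝ V] {Y : Type v}
    [RealAlgebraicVariety Y] (σ : V → Y) (y : Y) : Prop :=
  σ 0 = y ∧ ∀ δ : (ringed (X := Y)).regularAt y →ₗ[ℝ] ℝ, IsTangentVector y δ →
    ∃ v : V, ∀ φ : (ringed (X := Y)).regularAt y,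
      HasDerivAt (fun t : ℝ => φ.1 (σ (t • v))) (δ φ) 0

/-! ### Algebraic vector bundles, sprays, malleable varieties -/

/-- An algebraic vector bundle `p : E → Y` over a real algebraic variety `Y`.  The total space is
`E = Σ y, Fiber y`, with `p ⟨y, v⟩ = y`. -/
structure AlgebraicVectorBundle (Y : Type v) [RealAlgebraicVariety Y] where
  /-- the fibre `E_y` over `y` -/
  Fiber : Y → Type
  [addCommGroup : ∀ y, AddCommGroup (Fiber y)]
  [module : ∀ y, Module ℝ (Fiber y)]
  /-- the total space is a real algebraic variety -/
  [variety : RealAlgebraicVariety (Σ y, Fiber y)]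
  /-- the bundle projection is a regular map -/
  isMorphism_proj : (ringed (X := Σ y, Fiber y)).IsMorphism (ringed (X := Y)) Sigma.fst
  /-- Zariski local triviality: over some Zariski open neighbourhood `U` of each point there is an
  isomorphism of varieties `p⁻¹(U) ≃ U × ℝᵏ` which is a linear isomorphism on each fibre -/
  locally_trivial : ∀ y₀ : Y, ∃ U : Set Y, y₀ ∈ U ∧ IsOpen[(ringed (X := Y)).zariski] U ∧
    ∃ (k : ℕ) (e : {w : Σ y, Fiber y | w.1 ∈ U} ≃ U × (Fin k → ℝ)),
      ((ringed (X := Σ y, Fiber y)).sub _).IsIsomorphism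
        (((ringed (X := Y)).sub U).prod (affineSpace k)) e ∧
      ∀ y : U, ∃ L : Fiber y ≃ₗ[ℝ] (Fin k → ℝ), ∀ v : Fiber y, e ⟨⟨y, v⟩, y.2⟩ = (y, L v)
  /-- the bundle is isomorphic to a subbundle of a product bundle: there is a regular, fibrewise
  linear and injective morphism from `E` to some product bundle `Y × ℝᴺ` -/
  exists_injective : ∃ (N : ℕ) (j : ∀ y, Fiber y →ₗ[ℝ] (Fin N → ℝ)),
    (∀ y, Function.Injective (j y)) ∧
      (ringed (X := Σ y, Fiber y)).IsMorphism ((ringed (X := Y)).prod (affineSpace N))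
        (fun w => (w.1, j w.1 w.2))

attribute [instance] AlgebraicVectorBundle.addCommGroup AlgebraicVectorBundle.module
  AlgebraicVectorBundle.variety

/-- The total space of an algebraic vector bundle. -/
abbrev AlgebraicVectorBundle.Total {Y : Type v} [RealAlgebraicVariety Y]
    (E : AlgebraicVectorBundle Y) : Type v :=
  Σ y, E.Fiber y

/-- A spray `(E, p, s)` for `Y`: an algebraic vector bundle `p : E → Y` and a regular map
`s : E → Y` such that `s(0_y) = y` for all `y`. -/
structure Spray (Y : Type v) [RealAlgebraicVariety Y] where
  bundle : AlgebraicVectorBundle Y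
  map : RegularMap bundle.Total Y
  map_zero : ∀ y : Y, map ⟨y, 0⟩ = y

/-- A spray is dominating if for every `y` the map `E_y → Y`, `v ↦ s(v)`, is a submersion at the
zero vector of `E_y`. -/
def Spray.IsDominating {Y : Type v} [RealAlgebraicVariety Y] (𝒮 : Spray Y) : Prop :=
  ∀ y : Y, IsSubmersionAtZero (fun v : 𝒮.bundle.Fiber y => 𝒮.map ⟨y, v⟩) y

/-- A variety is malleable if it admits a dominating spray. -/
def IsMalleable (Y : Type v) [RealAlgebraicVariety Y] : Prop :=
  ∃ 𝒮 : Spray Y, 𝒮.IsDominating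

/-!
Let `s` be a dominating spray of `Y`.  The bundle of `s` embeds into a product bundle, and the
orthogonal projection of `Y × ℝᴺ` onto it is regular, so that one may assume that `s` is a regular
map `Y × ℝᴺ → Y` with `s (y, 0) = y` (`exists_spray_product`).

A map on a compact set `K ⊆ D` is called approximable if it is a limit of regular maps `X → Y`
which coincide with `f₀` on `A`.  If `h` is approximable and `η : K → ℝᴺ` is continuous and vanishes
on `A`, then `s (h, η)` is approximable: by the Stone-Weierstrass theorem `η` is a limit of regular
maps vanishing on `A` (`mem_closure_regular_vanishing`), and one can substitute approximations of
`h` and of `η` into the regular map `s` (`spray_mem_approximable`).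

As `Y` is nonsingular and `s` dominating, the inverse function theorem provides, near every point of
`Y`, a continuous solution `v = τ (y, y')` of `s (y, v) = y'` with `τ (y, y) = 0`
(`exists_local_inverse_spray`).  Hence a change of an approximable map which is supported in a
closed set, takes place within a small open subset of `Y` and fixes the points over `A` is of the
form `h ↦ s (h, η)` as above.  The homotopy from `f₀` to `f` decomposes over `K` into finitely many
such moves (`ContinuousMap.slice_one_mem_of_moves`), so `f` is approximable on every compact set.

Smooth and continuous functions are treated as structure sheaves as well (`smoothSpace`,
`continuousSpace`).  The calculus of morphisms then gives at one stroke that regular maps built from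
`s`, from charts and from bundle trivializations are regular, continuous, or differentiable in local
coordinates.
-/

universe w

/-! ### Morphisms at a point and local ringed spaces -/

namespace RingedFunctionSpace

variable {X : Type u} {Y : Type v} {Z : Type w}

/-- The filter of Zariski neighbourhoods of a point. -/
abbrev zariskiNhds (𝒳 : RingedFunctionSpace X) (x : X) : Filter X := @nhds X 𝒳.zariski x

theorem mem_of_zariskiNhds {𝒳 : RingedFunctionSpace X} {x : X} {p : X → Prop}
    (h : ∀ᶠ z in 𝒳.zariskiNhds x, p z) : p x :=
  @Filter.Eventually.self_of_nhds X 𝒳.zariski _ _ h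

/-- The condition for being a morphism of ringed spaces of functions, at a single point of the
source. -/
def IsMorphismAt (𝒳 : RingedFunctionSpace X) (𝒴 : RingedFunctionSpace Y) (f : X → Y) (x : X) :
    Prop :=
  Filter.Tendsto f (𝒳.zariskiNhds x) (𝒴.zariskiNhds (f x)) ∧
    ∀ φ ∈ 𝒴.regularAt (f x), φ ∘ f ∈ 𝒳.regularAt x

theorem isMorphism_iff {𝒳 : RingedFunctionSpace X} {𝒴 : RingedFunctionSpace Y} {f : X → Y} :
    IsMorphism 𝒳 𝒴 f ↔ ∀ x, IsMorphismAt 𝒳 𝒴 f x := by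
  unfold IsMorphism IsMorphismAt
  rw [@continuous_iff_continuousAt X Y 𝒳.zariski 𝒴.zariski, forall_and]
  rfl

theorem IsMorphism.isMorphismAt {𝒳 : RingedFunctionSpace X} {𝒴 : RingedFunctionSpace Y}
    {f : X → Y} (h : IsMorphism 𝒳 𝒴 f) (x : X) : IsMorphismAt 𝒳 𝒴 f x :=
  isMorphism_iff.1 h x

theorem isMorphismAt_id (𝒳 : RingedFunctionSpace X) (x : X) : IsMorphismAt 𝒳 𝒳 id x :=
  ⟨Filter.tendsto_id, fun _ h => h⟩

theorem IsMorphismAt.comp {𝒳 : RingedFunctionSpace X} {𝒴 : RingedFunctionSpace Y}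
    {𝒵 : RingedFunctionSpace Z} {g : Y → Z} {f : X → Y} {x : X}
    (hg : IsMorphismAt 𝒴 𝒵 g (f x)) (hf : IsMorphismAt 𝒳 𝒴 f x) :
    IsMorphismAt 𝒳 𝒵 (g ∘ f) x :=
  ⟨hg.1.comp hf.1, fun φ h => hf.2 _ (hg.2 φ h)⟩

theorem IsMorphismAt.congr {𝒳 : RingedFunctionSpace X} {𝒴 : RingedFunctionSpace Y} {f g : X → Y}
    {x : X} (hf : IsMorphismAt 𝒳 𝒴 f x) (h : ∀ᶠ z in 𝒳.zariskiNhds x, g z = f z) :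
    IsMorphismAt 𝒳 𝒴 g x := by
  have hx : g x = f x := mem_of_zariskiNhds (p := fun z => g z = f z) h
  refine ⟨?_, fun φ hφ => ?_⟩
  · rw [hx]
    exact hf.1.congr' (h.mono fun z hz => hz.symm)
  · rw [hx] at hφ
    exact 𝒳.regularAt_congr x _ _ (hf.2 φ hφ) (h.mono fun z hz => by simp [hz])

/-- A ringed space of functions is local if a regular function which does not vanish at a point
does not vanish nearby and has a regular inverse. -/
def IsLocal (𝒳 : RingedFunctionSpace X) : Prop :=
  ∀ (x : X), ∀ φ ∈ 𝒳.regularAt x, φ x ≠ 0 →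
    (∀ᶠ z in 𝒳.zariskiNhds x, φ z ≠ 0) ∧ φ⁻¹ ∈ 𝒳.regularAt x

theorem IsMorphismAt.eventually_mem {𝒳 : RingedFunctionSpace X} {𝒴 : RingedFunctionSpace Y}
    {f : X → Y} {x : X} (hf : IsMorphismAt 𝒳 𝒴 f x) {U : Set Y} (hU : IsOpen[𝒴.zariski] U)
    (hx : f x ∈ U) : ∀ᶠ z in 𝒳.zariskiNhds x, f z ∈ U := by
  let := 𝒴.zariski
  exact hf.1 (hU.mem_nhds hx)

theorem isLocal_iso {𝒳 : RingedFunctionSpace X} {𝒴 : RingedFunctionSpace Y} {e : X ≃ Y}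
    (he : IsIsomorphism 𝒳 𝒴 e) (h : IsLocal 𝒴) : IsLocal 𝒳 := by
  intro x φ hφ hx
  have h1 := he.1.isMorphismAt x
  have h2 := he.2.isMorphismAt (e x)
  have h3 : φ ∘ e.symm ∈ 𝒴.regularAt (e x) := h2.2 φ (by simpa using hφ)
  obtain ⟨h4, h5⟩ := h (e x) _ h3 (by simpa using hx)
  refine ⟨(h1.1.eventually h4).mono fun z hz => by simpa using hz, ?_⟩
  have := h1.2 _ h5
  convert this using 1
  ext z; simp

/-! ### Morphisms into and out of subspaces, products and affine spaces -/

theorem isMorphismAt_subtypeVal (𝒳 : RingedFunctionSpace X) (S : Set X) (x : S) :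
    IsMorphismAt (𝒳.sub S) 𝒳 Subtype.val x := by
  refine ⟨?_, fun φ hφ => ⟨φ, hφ, Filter.Eventually.of_forall fun _ => rfl⟩⟩
  let := 𝒳.zariski
  exact continuous_subtype_val.tendsto x

theorem IsMorphismAt.codRestrict {𝒳 : RingedFunctionSpace X} {𝒴 : RingedFunctionSpace Y}
    {S : Set Y} {f : X → S} {x : X} (h : IsMorphismAt 𝒳 𝒴 (fun z => (f z).1) x) :
    IsMorphismAt 𝒳 (𝒴.sub S) f x := by
  have ht : Filter.Tendsto f (𝒳.zariskiNhds x) ((𝒴.sub S).zariskiNhds (f x)) := by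
    let := 𝒴.zariski
    exact tendsto_subtype_rng.2 h.1
  refine ⟨ht, ?_⟩
  rintro φ ⟨g, hg, hφ⟩
  exact 𝒳.regularAt_congr x _ _ (h.2 g hg) (ht.eventually hφ)

theorem isLocal_sub {𝒳 : RingedFunctionSpace X} (h : IsLocal 𝒳) (S : Set X) :
    IsLocal (𝒳.sub S) := by
  rintro x φ ⟨g, hg, hφ⟩ hx
  have hφ' : ∀ᶠ s in (𝒳.sub S).zariskiNhds x, φ s = g s.1 := hφ
  have hgx : g x.1 ≠ 0 := by rwa [← mem_of_zariskiNhds hφ']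
  obtain ⟨h1, h2⟩ := h x.1 g hg hgx
  refine ⟨?_, g⁻¹, h2, hφ.mono fun s hs => by simp [hs]⟩
  filter_upwards [hφ', (isMorphismAt_subtypeVal 𝒳 S x).1.eventually h1] with z h3 h4
  rwa [h3]

theorem mem_boxSections_fst (𝒳 : RingedFunctionSpace X) (𝒴 : RingedFunctionSpace Y) {U : Set X}
    {V : Set Y} {a : X → ℝ} (ha : a ∈ 𝒳.sections U) : a ∘ Prod.fst ∈ boxSections 𝒳 𝒴 U V :=
  Algebra.subset_adjoin (Or.inl ⟨a, ha, rfl⟩)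

theorem mem_boxSections_snd (𝒳 : RingedFunctionSpace X) (𝒴 : RingedFunctionSpace Y) {U : Set X}
    {V : Set Y} {b : Y → ℝ} (hb : b ∈ 𝒴.sections V) : b ∘ Prod.snd ∈ boxSections 𝒳 𝒴 U V :=
  Algebra.subset_adjoin (Or.inr ⟨b, hb, rfl⟩)

theorem exists_isOpen_mem_sections (𝒳 : RingedFunctionSpace X) {x : X} {φ : X → ℝ}
    (h : φ ∈ 𝒳.regularAt x) : ∃ U, IsOpen[𝒳.zariski] U ∧ x ∈ U ∧ φ ∈ 𝒳.sections U := by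
  let := 𝒳.zariski
  obtain ⟨U, hU, hUo, hx⟩ := eventually_nhds_iff.1 (𝒳.regularAt_eventually x φ h)
  exact ⟨U, hUo, hx, mem_sections.2 hU⟩

theorem regularAt_prod_of_boxSections (𝒳 : RingedFunctionSpace X) (𝒴 : RingedFunctionSpace Y)
    {U : Set X} {V : Set Y} (hU : IsOpen[𝒳.zariski] U) (hV : IsOpen[𝒴.zariski] V) {z : X × Y}
    (h1 : z.1 ∈ U) (h2 : z.2 ∈ V) {g : X × Y → ℝ} (hg : g ∈ boxSections 𝒳 𝒴 U V) :
    g ∈ (𝒳.prod 𝒴).regularAt z :=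
  ⟨U, V, hU, hV, h1, h2, g, hg, 1, one_mem _, Filter.Eventually.of_forall fun w => by simp⟩

theorem isMorphismAt_fst (𝒳 : RingedFunctionSpace X) (𝒴 : RingedFunctionSpace Y) (z : X × Y) :
    IsMorphismAt (𝒳.prod 𝒴) 𝒳 Prod.fst z := by
  refine ⟨?_, fun φ hφ => ?_⟩
  · refine (@nhds_basis_opens X 𝒳.zariski z.1).tendsto_right_iff.2 fun U hU => ?_
    exact (eventually_prodZariski 𝒳 𝒴 hU.2 (@isOpen_univ _ 𝒴.zariski) hU.1 trivial).mono
      fun w hw => hw.1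
  · obtain ⟨U, hU, hx, h⟩ := 𝒳.exists_isOpen_mem_sections hφ
    exact regularAt_prod_of_boxSections 𝒳 𝒴 hU (@isOpen_univ _ 𝒴.zariski) hx trivial
      (mem_boxSections_fst 𝒳 𝒴 h)

theorem isMorphismAt_snd (𝒳 : RingedFunctionSpace X) (𝒴 : RingedFunctionSpace Y) (z : X × Y) :
    IsMorphismAt (𝒳.prod 𝒴) 𝒴 Prod.snd z := by
  refine ⟨?_, fun φ hφ => ?_⟩
  · refine (@nhds_basis_opens Y 𝒴.zariski z.2).tendsto_right_iff.2 fun U hU => ?_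
    exact (eventually_prodZariski 𝒳 𝒴 (@isOpen_univ _ 𝒳.zariski) hU.2 trivial hU.1).mono
      fun w hw => hw.2
  · obtain ⟨U, hU, hx, h⟩ := 𝒴.exists_isOpen_mem_sections hφ
    exact regularAt_prod_of_boxSections 𝒳 𝒴 (@isOpen_univ _ 𝒳.zariski) hU trivial hx
      (mem_boxSections_snd 𝒳 𝒴 h)

theorem isLocal_prod (𝒳 : RingedFunctionSpace X) (𝒴 : RingedFunctionSpace Y) :
    IsLocal (𝒳.prod 𝒴) := by
  rintro z φ ⟨U, V, hU, hV, h1, h2, g, hg, h, hh, H⟩ hz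
  have H' : ∀ᶠ w in (𝒳.prod 𝒴).zariskiNhds z, h w ≠ 0 ∧ φ w = g w / h w := H
  have hgz : g z ≠ 0 := fun h0 => hz (by rw [(mem_of_zariskiNhds H').2, h0, zero_div])
  have ho : IsOpen[prodZariski 𝒳 𝒴] {w : X × Y | w.1 ∈ U ∧ w.2 ∈ V ∧ g w ≠ 0} :=
    TopologicalSpace.isOpen_generateFrom_of_mem ⟨U, V, hU, hV, g, hg, rfl⟩
  have hn : ∀ᶠ w in @nhds _ (prodZariski 𝒳 𝒴) z, g w ≠ 0 := by
    let := prodZariski 𝒳 𝒴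
    filter_upwards [ho.mem_nhds ⟨h1, h2, hgz⟩] with w hw using hw.2.2
  refine ⟨?_, U, V, hU, hV, h1, h2, h, hh, g, hg, ?_⟩
  · filter_upwards [H, hn] with w hw hw'
    rw [hw.2]
    exact div_ne_zero hw' hw.1
  · filter_upwards [H, hn] with w hw hw'
    exact ⟨hw', by simp [hw.2]⟩

theorem comp_mem_regularAt_of_boxSections {𝒳 : RingedFunctionSpace X} {𝒴 : RingedFunctionSpace Y}
    {𝒵 : RingedFunctionSpace Z} {f : X → Y × Z} {x : X}
    (h1 : IsMorphismAt 𝒳 𝒴 (fun z => (f z).1) x) (h2 : IsMorphismAt 𝒳 𝒵 (fun z => (f z).2) x)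
    {U : Set Y} {V : Set Z} (hU : (f x).1 ∈ U) (hV : (f x).2 ∈ V) {g : Y × Z → ℝ}
    (hg : g ∈ boxSections 𝒴 𝒵 U V) : g ∘ f ∈ 𝒳.regularAt x := by
  induction hg using Algebra.adjoin_induction with
  | mem g hg =>
    rcases hg with ⟨a, ha, rfl⟩ | ⟨b, hb, rfl⟩
    · exact h1.2 a (mem_sections.1 ha _ hU)
    · exact h2.2 b (mem_sections.1 hb _ hV)
  | algebraMap r => exact Subalgebra.algebraMap_mem _ r
  | add a b _ _ ha hb => exact add_mem ha hb
  | mul a b _ _ ha hb => exact mul_mem ha hb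

/-- The universal property of the product, for maps from a local ringed space. -/
theorem IsMorphismAt.prodMk {𝒳 : RingedFunctionSpace X} {𝒴 : RingedFunctionSpace Y}
    {𝒵 : RingedFunctionSpace Z} (hX : IsLocal 𝒳) {f : X → Y × Z} {x : X}
    (h1 : IsMorphismAt 𝒳 𝒴 (fun z => (f z).1) x) (h2 : IsMorphismAt 𝒳 𝒵 (fun z => (f z).2) x) :
    IsMorphismAt 𝒳 (𝒴.prod 𝒵) f x := by
  have ht : Filter.Tendsto f (𝒳.zariskiNhds x) ((𝒴.prod 𝒵).zariskiNhds (f x)) := by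
    refine TopologicalSpace.tendsto_nhds_generateFrom_iff.2 ?_
    rintro _ ⟨U, V, hU, hV, g, hg, rfl⟩ ⟨hxU, hxV, hgx⟩
    have h3 := (hX x _ (comp_mem_regularAt_of_boxSections h1 h2 hxU hxV hg) hgx).1
    filter_upwards [h1.eventually_mem hU hxU, h2.eventually_mem hV hxV, h3] with z a b c
    exact ⟨a, b, c⟩
  refine ⟨ht, ?_⟩
  rintro φ ⟨U, V, hU, hV, hxU, hxV, g, hg, h, hh, H⟩
  have H' : ∀ᶠ w in (𝒴.prod 𝒵).zariskiNhds (f x), h w ≠ 0 ∧ φ w = g w / h w := H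
  have hg' := comp_mem_regularAt_of_boxSections h1 h2 hxU hxV hg
  have hh' := comp_mem_regularAt_of_boxSections h1 h2 hxU hxV hh
  have hi := (hX x _ hh' (mem_of_zariskiNhds H').1).2
  refine 𝒳.regularAt_congr x _ _ (mul_mem hg' hi) ?_
  filter_upwards [ht.eventually H'] with z hz
  simp [hz.2, div_eq_mul_inv]

theorem coord_mem_regularAt {n : ℕ} (i : Fin n) (x : Fin n → ℝ) :
    (fun z : Fin n → ℝ => z i) ∈ (affineSpace n).regularAt x :=
  ⟨MvPolynomial.X i, 1, Filter.Eventually.of_forall fun z => by simp⟩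

theorem eval_comp_mem_regularAt {𝒳 : RingedFunctionSpace X} {n : ℕ} {f : X → Fin n → ℝ} {x : X}
    (h : ∀ i, (fun z => f z i) ∈ 𝒳.regularAt x) (Q : MvPolynomial (Fin n) ℝ) :
    (fun z => MvPolynomial.eval (f z) Q) ∈ 𝒳.regularAt x := by
  induction Q using MvPolynomial.induction_on with
  | C r =>
    simp only [MvPolynomial.eval_C]
    exact Subalgebra.algebraMap_mem (𝒳.regularAt x) r
  | add p q hp hq =>
    simp only [map_add]
    exact add_mem hp hq
  | mul_X p i hp =>
    simp only [map_mul, MvPolynomial.eval_X]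
    exact mul_mem hp (h i)

theorem isMorphismAt_affineSpace {𝒳 : RingedFunctionSpace X} (hX : IsLocal 𝒳) {n : ℕ}
    {f : X → Fin n → ℝ} {x : X} (h : ∀ i, (fun z => f z i) ∈ 𝒳.regularAt x) :
    IsMorphismAt 𝒳 (affineSpace n) f x := by
  have ht : Filter.Tendsto f (𝒳.zariskiNhds x) ((affineSpace n).zariskiNhds (f x)) := by
    refine TopologicalSpace.tendsto_nhds_generateFrom_iff.2 ?_
    rintro _ ⟨Q, rfl⟩ hQ
    exact (hX x _ (eval_comp_mem_regularAt h Q) hQ).1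
  refine ⟨ht, ?_⟩
  rintro φ ⟨P, Q, H⟩
  have H' : ∀ᶠ z in (affineSpace n).zariskiNhds (f x), MvPolynomial.eval z Q ≠ 0 ∧
    φ z = MvPolynomial.eval z P / MvPolynomial.eval z Q := H
  have hi := (hX x _ (eval_comp_mem_regularAt h Q) (mem_of_zariskiNhds H').1).2
  refine 𝒳.regularAt_congr x _ _ (mul_mem (eval_comp_mem_regularAt h P) hi) ?_
  filter_upwards [ht.eventually H'] with z hz
  simp [hz.2, div_eq_mul_inv]

theorem IsMorphismAt.coord_mem_regularAt {𝒳 : RingedFunctionSpace X} {n : ℕ}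
    {f : X → Fin n → ℝ} {x : X} (h : IsMorphismAt 𝒳 (affineSpace n) f x) (i : Fin n) :
    (fun z => f z i) ∈ 𝒳.regularAt x :=
  h.2 _ (RingedFunctionSpace.coord_mem_regularAt i _)

/-! ### Continuous and differentiable functions as ringed spaces -/

/-- A topological space with the sheaf of continuous functions. -/
def continuousSpace (T : Type u) [t : TopologicalSpace T] : RingedFunctionSpace T where
  zariski := t
  regularAt x :=
    { carrier := {f | ∀ᶠ z in 𝓝 x, ContinuousAt f z}
      mul_mem' := by
        intro f g hf hg
        filter_upwards [hf, hg] with z h1 h2 using h1.mul h2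
      add_mem' := by
        intro f g hf hg
        filter_upwards [hf, hg] with z h1 h2 using h1.add h2
      algebraMap_mem' := fun r => Filter.Eventually.of_forall fun z => continuousAt_const }
  regularAt_congr := by
    intro x f g hf hg
    have hg' : ∀ᶠ z in 𝓝 x, ∀ᶠ w in 𝓝 z, g w = f w := eventually_eventually_nhds.2 hg
    filter_upwards [hf, hg'] with z h1 h2
    exact h1.congr (h2.mono fun _ h => h.symm)
  regularAt_eventually := fun x f hf => eventually_eventually_nhds.2 hf

theorem isLocal_continuousSpace (T : Type u) [TopologicalSpace T] : IsLocal (continuousSpace T) := by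
  intro x φ hφ hx
  have hφ' : ∀ᶠ z in 𝓝 x, ContinuousAt φ z := hφ
  have h0 : ∀ᶠ z in 𝓝 x, φ z ≠ 0 := hφ'.self_of_nhds.eventually_ne hx
  refine ⟨h0, ?_⟩
  change ∀ᶠ z in 𝓝 x, ContinuousAt φ⁻¹ z
  filter_upwards [hφ', h0] with z h1 h2 using h1.inv₀ h2

/-- A map is continuous for the Euclidean topology of the target as soon as it pulls back regular
functions to continuous functions. -/
theorem continuous_of_isMorphismAt_continuousSpace {T : Type u} [TopologicalSpace T]
    {𝒴 : RingedFunctionSpace Y} {f : T → Y} (h : ∀ x, IsMorphismAt (continuousSpace T) 𝒴 f x) :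
    Continuous[_, 𝒴.euclidean] f := by
  refine continuous_generateFrom_iff.2 ?_
  rintro _ ⟨U, hU, φ, hφ, I, hI, rfl⟩
  refine isOpen_iff_mem_nhds.2 fun x hx => ?_
  have h1 : ∀ᶠ z in 𝓝 x, f z ∈ U := (h x).eventually_mem hU hx.1
  have h2 : ∀ᶠ z in 𝓝 x, ContinuousAt (φ ∘ f) z := (h x).2 φ (mem_sections.1 hφ _ hx.1)
  filter_upwards [h1, h2.self_of_nhds.preimage_mem_nhds (hI.mem_nhds hx.2)] with z h3 h4
  exact ⟨h3, h4⟩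

/-- The identity is a morphism from the Euclidean topology, with the sheaf of continuous functions,
to the ringed space itself. -/
theorem isMorphismAt_continuousSpace_euclidean (𝒳 : RingedFunctionSpace X) (x : X) :
    IsMorphismAt (@continuousSpace X 𝒳.euclidean) 𝒳 id x := by
  let := 𝒳.euclidean
  have hle : ∀ U : Set X, IsOpen[𝒳.zariski] U → IsOpen U := fun U hU =>
    TopologicalSpace.isOpen_generateFrom_of_mem
      ⟨U, hU, 1, one_mem _, Set.univ, isOpen_univ, by simp⟩
  refine ⟨?_, fun φ hφ => ?_⟩
  · refine (@nhds_basis_opens X 𝒳.zariski x).tendsto_right_iff.2 fun U hU => ?_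
    exact (hle U hU.2).mem_nhds hU.1
  · obtain ⟨U, hU, hx, h⟩ := 𝒳.exists_isOpen_mem_sections hφ
    change ∀ᶠ z in 𝓝 x, ContinuousAt φ z
    filter_upwards [(hle U hU).mem_nhds hx] with z hz
    refine continuousAt_def.2 fun I hI => ?_
    obtain ⟨J, hJI, hJ, hzJ⟩ := mem_nhds_iff.1 hI
    have : IsOpen (U ∩ φ ⁻¹' J) :=
      TopologicalSpace.isOpen_generateFrom_of_mem ⟨U, hU, φ, h, J, hJ, rfl⟩
    exact Filter.mem_of_superset (this.mem_nhds ⟨hz, hzJ⟩) fun w hw => hJI hw.2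

/-- A subset `T` of a normed space with the Euclidean topology and the sheaf of functions which
locally extend to `C¹` functions on the ambient space. -/
def smoothSpace {V : Type u} [NormedAddCommGroup V] [NormedSpace ℝ V] (T : Set V) :
    RingedFunctionSpace T where
  zariski := inferInstance
  regularAt x :=
    { carrier := {f | ∃ g : V → ℝ, ContDiffAt ℝ 1 g x ∧ ∀ᶠ z in 𝓝 x, f z = g z}
      mul_mem' := by
        rintro f f' ⟨g, hg, h⟩ ⟨g', hg', h'⟩
        exact ⟨g * g', hg.mul hg', by filter_upwards [h, h'] with s h h'; simp [h, h']⟩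
      add_mem' := by
        rintro f f' ⟨g, hg, h⟩ ⟨g', hg', h'⟩
        exact ⟨g + g', hg.add hg', by filter_upwards [h, h'] with s h h'; simp [h, h']⟩
      algebraMap_mem' := fun r =>
        ⟨fun _ => r, contDiffAt_const, Filter.Eventually.of_forall fun z => rfl⟩ }
  regularAt_congr := by
    rintro x f f' ⟨g, hg, h⟩ h'
    exact ⟨g, hg, by filter_upwards [h, h'] with s h h'; rw [h', h]⟩
  regularAt_eventually := by
    rintro x f ⟨g, hg, h⟩
    have h1 : ∀ᶠ z : T in 𝓝 x, ContDiffAt ℝ 1 g z :=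
      continuous_subtype_val.continuousAt.eventually (hg.eventually (by simp))
    filter_upwards [h1, eventually_eventually_nhds.2 h] with z h1 h2
    exact ⟨g, h1, h2⟩

theorem isLocal_smoothSpace {V : Type u} [NormedAddCommGroup V] [NormedSpace ℝ V] (T : Set V) :
    IsLocal (smoothSpace T) := by
  rintro x φ ⟨g, hg, h⟩ hx
  have hgx : g x ≠ 0 := by rwa [← h.self_of_nhds]
  refine ⟨?_, g⁻¹, hg.inv hgx, h.mono fun z hz => by simp [hz]⟩
  have h1 : ∀ᶠ z : T in 𝓝 x, g z ≠ 0 :=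
    continuous_subtype_val.continuousAt.eventually (hg.continuousAt.eventually_ne hgx)
  change ∀ᶠ z : T in 𝓝 x, φ z ≠ 0
  filter_upwards [h, h1] with z h2 h3
  rwa [h2]

end RingedFunctionSpace

/-! ### Global regular functions on real algebraic varieties -/

open RingedFunctionSpace

theorem sum_sq_rep_pos {n : ℕ} (p : RealProjectiveSpace n) : 0 < ∑ i, p.rep i ^ 2 := by
  obtain ⟨i, hi⟩ := Function.ne_iff.1 p.rep_nonzero
  exact Finset.sum_pos' (fun i _ => sq_nonneg _) ⟨i, Finset.mem_univ i, sq_pos_of_ne_zero hi⟩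

/-- Over `ℝ` the form `∑ xᵢ²` vanishes nowhere on projective space, so that every homogeneous
polynomial `Q` of degree `d` yields a global regular function `Q² / (∑ xᵢ²)ᵈ`. -/
theorem sq_div_mem_regularAt {n d : ℕ} {Q : MvPolynomial (Fin (n + 1)) ℝ} (hQ : Q.IsHomogeneous d)
    (x : RealProjectiveSpace n) :
    (fun p : RealProjectiveSpace n => MvPolynomial.eval p.rep Q ^ 2 / (∑ i, p.rep i ^ 2) ^ d) ∈
      (projectiveSpace n).regularAt x := by
  refine ⟨2 * d, Q ^ 2, (∑ i, MvPolynomial.X i ^ 2) ^ d, ?_, ?_,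
    Filter.Eventually.of_forall fun p => ⟨?_, by simp⟩⟩
  · rw [mul_comm]
    exact hQ.pow 2
  · exact (MvPolynomial.IsHomogeneous.sum _ _ 2 fun i _ => by
      simpa using (MvPolynomial.isHomogeneous_X ℝ i).pow 2).pow d
  · simpa using pow_ne_zero d (sum_sq_rep_pos p).ne'

theorem isLocal_projectiveSpace (n : ℕ) : IsLocal (projectiveSpace n) := by
  rintro x φ ⟨d, P, Q, hP, hQ, H⟩ hx
  have H' : ∀ᶠ p in (projectiveSpace n).zariskiNhds x, MvPolynomial.eval p.rep Q ≠ 0 ∧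
    φ p = MvPolynomial.eval p.rep P / MvPolynomial.eval p.rep Q := H
  have hPx : MvPolynomial.eval x.rep P ≠ 0 := fun h0 =>
    hx (by rw [(mem_of_zariskiNhds H').2, h0, zero_div])
  have hn : ∀ᶠ p in (projectiveSpace n).zariskiNhds x, MvPolynomial.eval p.rep P ≠ 0 := by
    let := projectiveZariski n
    have ho : IsOpen {p : RealProjectiveSpace n | MvPolynomial.eval p.rep P ≠ 0} :=
      TopologicalSpace.isOpen_generateFrom_of_mem ⟨d, P, hP, rfl⟩
    exact ho.mem_nhds hPx
  refine ⟨?_, d, Q, P, hQ, hP, ?_⟩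
  · filter_upwards [H', hn] with p h1 h2
    rw [h1.2]
    exact div_ne_zero h2 h1.1
  · filter_upwards [H', hn] with p h1 h2
    exact ⟨h2, by simp [h1.2]⟩

theorem exists_isHomogeneous_of_isOpen {n : ℕ} {U : Set (RealProjectiveSpace n)}
    (hU : IsOpen[projectiveZariski n] U) {x : RealProjectiveSpace n} (hx : x ∈ U) :
    ∃ (d : ℕ) (Q : MvPolynomial (Fin (n + 1)) ℝ), Q.IsHomogeneous d ∧
      MvPolynomial.eval x.rep Q ≠ 0 ∧ ∀ p ∉ U, MvPolynomial.eval p.rep Q = 0 := by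
  have hU' : TopologicalSpace.GenerateOpen _ U := hU
  clear hU
  induction hU' with
  | basic s hs =>
    obtain ⟨d, Q, hQ, rfl⟩ := hs
    exact ⟨d, Q, hQ, hx, fun p hp => by simpa using hp⟩
  | univ => exact ⟨0, 1, MvPolynomial.isHomogeneous_one _ _, by simp, fun p hp => (hp trivial).elim⟩
  | inter s t _ _ hs ht =>
    obtain ⟨d, Q, hQ, h1, h2⟩ := hs hx.1
    obtain ⟨d', Q', hQ', h1', h2'⟩ := ht hx.2
    refine ⟨d + d', Q * Q', hQ.mul hQ', by simp [h1, h1'], fun p hp => ?_⟩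
    by_cases h : p ∈ s
    · simp [h2' p fun h' => hp ⟨h, h'⟩]
    · simp [h2 p h]
  | sUnion S _ hS =>
    obtain ⟨s, hs, hxs⟩ := hx
    obtain ⟨d, Q, hQ, h1, h2⟩ := hS s hs hxs
    exact ⟨d, Q, hQ, h1, fun p hp => h2 p fun h => hp ⟨s, hs, h⟩⟩

/-- For `y ≠ x` one of the linear forms `yⱼ Xᵢ - yᵢ Xⱼ`, which vanish at `y`, does not vanish
at `x`. -/
theorem exists_linear_separating {n : ℕ} {x y : RealProjectiveSpace n} (h : x ≠ y) :
    ∃ Q : MvPolynomial (Fin (n + 1)) ℝ, Q.IsHomogeneous 1 ∧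
      MvPolynomial.eval x.rep Q ≠ 0 ∧ MvPolynomial.eval y.rep Q = 0 := by
  by_contra! H
  have key : ∀ i j, x.rep i * y.rep j = x.rep j * y.rep i := by
    intro i j
    have hQ : (MvPolynomial.C (y.rep j) * MvPolynomial.X i -
        MvPolynomial.C (y.rep i) * MvPolynomial.X j :
        MvPolynomial (Fin (n + 1)) ℝ).IsHomogeneous 1 := by
      refine MvPolynomial.IsHomogeneous.sub ?_ ?_
      · simpa using (MvPolynomial.isHomogeneous_C _ (y.rep j)).mul
          (MvPolynomial.isHomogeneous_X ℝ i)
      · simpa using (MvPolynomial.isHomogeneous_C _ (y.rep i)).mul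
          (MvPolynomial.isHomogeneous_X ℝ j)
    by_contra hne
    refine H _ hQ (fun h0 => hne ?_) ?_
    · simp only [map_sub, map_mul, MvPolynomial.eval_C, MvPolynomial.eval_X] at h0
      linarith
    · simp [mul_comm]
  obtain ⟨j, hj⟩ := Function.ne_iff.1 y.rep_nonzero
  have hj : y.rep j ≠ 0 := hj
  apply h
  rw [← x.mk_rep, ← y.mk_rep, Projectivization.mk_eq_mk_iff']
  refine ⟨x.rep j / y.rep j, funext fun i => ?_⟩
  simp only [Pi.smul_apply, smul_eq_mul]
  field_simp
  linarith [key i j]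

section Variety

variable {X : Type u} [RealAlgebraicVariety X]

theorem isLocal_ringed (X : Type u) [RealAlgebraicVariety X] : IsLocal (ringed (X := X)) := by
  obtain ⟨n, V, -, e, he⟩ := RealAlgebraicVariety.exists_isIsomorphism (X := X)
  exact isLocal_iso he (isLocal_sub (isLocal_projectiveSpace n) V)

/-- Zariski closed sets are cut out by global regular functions. -/
theorem exists_regular_vanishing {A : Set X} (hA : IsZariskiClosed A) {x : X} (hx : x ∉ A) :
    ∃ α : X → ℝ, (∀ z, α ∈ (ringed (X := X)).regularAt z) ∧ (∀ z ∈ A, α z = 0) ∧ α x ≠ 0 := by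
  obtain ⟨n, V, -, e, he⟩ := RealAlgebraicVariety.exists_isIsomorphism (X := X)
  have ho : IsOpen[((projectiveSpace n).sub V).zariski] (e.symm ⁻¹' Aᶜ) := by
    let := (ringed (X := X)).zariski
    let := ((projectiveSpace n).sub V).zariski
    exact he.2.1.isOpen_preimage _ (isOpen_compl_iff.2 hA)
  obtain ⟨U, hU, hUV⟩ := (@isOpen_induced_iff _ _ (projectiveSpace n).zariski _ _).1 ho
  have hmem : ∀ z : X, (e z).1 ∈ U ↔ z ∉ A := fun z => by
    have : e z ∈ Subtype.val ⁻¹' U ↔ e z ∈ e.symm ⁻¹' Aᶜ := by rw [hUV]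
    simpa using this
  obtain ⟨d, Q, hQ, h1, h2⟩ := exists_isHomogeneous_of_isOpen hU ((hmem x).2 hx)
  refine ⟨_, fun z => ((isMorphismAt_subtypeVal _ _ _).comp (he.1.isMorphismAt z)).2 _
    (sq_div_mem_regularAt hQ _), fun z hz => ?_, ?_⟩
  · simp [h2 _ fun h => (hmem z).1 h hz]
  · exact div_ne_zero (pow_ne_zero 2 h1) (pow_ne_zero d (sum_sq_rep_pos _).ne')

theorem exists_regular_separating {x y : X} (h : x ≠ y) :
    ∃ α : X → ℝ, (∀ z, α ∈ (ringed (X := X)).regularAt z) ∧ α x ≠ α y := by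
  obtain ⟨n, V, -, e, he⟩ := RealAlgebraicVariety.exists_isIsomorphism (X := X)
  have hne : (e x).1 ≠ (e y).1 := fun h' => h (e.injective (Subtype.ext h'))
  obtain ⟨Q, hQ, h1, h2⟩ := exists_linear_separating hne
  refine ⟨_, fun z => ((isMorphismAt_subtypeVal _ _ _).comp (he.1.isMorphismAt z)).2 _
    (sq_div_mem_regularAt hQ _), ?_⟩
  have h3 : MvPolynomial.eval (e x).1.rep Q ^ 2 / (∑ i, (e x).1.rep i ^ 2) ^ 1 ≠ 0 :=
    div_ne_zero (pow_ne_zero 2 h1) (pow_ne_zero _ (sum_sq_rep_pos _).ne')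
  simpa [h2] using h3

theorem isMorphismAt_continuousSpace (x : X) :
    IsMorphismAt (continuousSpace X) (ringed (X := X)) id x := by
  have h := isMorphismAt_continuousSpace_euclidean (ringed (X := X)) x
  rwa [← RealAlgebraicVariety.topology_eq (X := X)] at h

theorem continuousAt_of_mem_regularAt {φ : X → ℝ} {x : X}
    (h : φ ∈ (ringed (X := X)).regularAt x) : ContinuousAt φ x := by
  have : ∀ᶠ z in 𝓝 x, ContinuousAt φ z := (isMorphismAt_continuousSpace x).2 φ h
  exact this.self_of_nhds

theorem isOpen_of_zariski {U : Set X} (h : IsOpen[(ringed (X := X)).zariski] U) : IsOpen U :=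
  isOpen_iff_mem_nhds.2 fun x hx => (isMorphismAt_continuousSpace x).eventually_mem h hx

theorem continuous_of_isMorphismAt {T : Type w} [TopologicalSpace T] {f : T → X}
    (h : ∀ t, IsMorphismAt (continuousSpace T) (ringed (X := X)) f t) : Continuous f := by
  have := continuous_of_isMorphismAt_continuousSpace h
  rwa [← RealAlgebraicVariety.topology_eq (X := X)] at this

theorem t2Space_variety (X : Type u) [RealAlgebraicVariety X] : T2Space X := by
  refine T2Space.of_injective_continuous
    (f := fun (x : X) (α : {α : X → ℝ // ∀ z, α ∈ (ringed (X := X)).regularAt z}) => α.1 x) ?_ ?_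
  · intro x y hxy
    by_contra h
    obtain ⟨α, hα, hne⟩ := exists_regular_separating h
    exact hne (congrFun hxy ⟨α, hα⟩)
  · exact continuous_pi fun α => continuous_iff_continuousAt.2 fun x =>
      continuousAt_of_mem_regularAt (α.2 x)

end Variety

/-! ### The relative Weierstrass approximation theorem -/

/-- The algebra of global regular functions on a variety. -/
def globalRegular (X : Type u) [RealAlgebraicVariety X] : Subalgebra ℝ (X → ℝ) :=
  (ringed (X := X)).sections Set.univ

theorem mem_globalRegular {X : Type u} [RealAlgebraicVariety X] {φ : X → ℝ} :
    φ ∈ globalRegular X ↔ ∀ x, φ ∈ (ringed (X := X)).regularAt x := by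
  simp [globalRegular, mem_sections]

theorem continuous_of_mem_globalRegular {X : Type u} [RealAlgebraicVariety X] {φ : X → ℝ}
    (h : φ ∈ globalRegular X) : Continuous φ :=
  continuous_iff_continuousAt.2 fun x => continuousAt_of_mem_regularAt (mem_globalRegular.1 h x)

/-- The pullback of global regular functions along a continuous map. -/
def pullbackRegular {X : Type u} [RealAlgebraicVariety X] {K : Type w} [TopologicalSpace K]
    (ι : C(K, X)) : globalRegular X →ₐ[ℝ] C(K, ℝ) where
  toFun φ := ⟨fun k => φ.1 (ι k), (continuous_of_mem_globalRegular φ.2).comp ι.continuous⟩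
  map_one' := rfl
  map_mul' _ _ := rfl
  map_zero' := rfl
  map_add' _ _ := rfl
  commutes' _ := rfl

/-- Relative Weierstrass approximation: by the Stone-Weierstrass theorem the regular functions are
dense in `C(K, ℝ)`, and the closed ideal generated by those which vanish on `A` consists of all
functions which vanish on `K ∩ A`. -/
theorem mem_closure_regular_vanishing {X : Type u} [RealAlgebraicVariety X] {K : Type w}
    [TopologicalSpace K] [CompactSpace K] {ι : C(K, X)} (hι : Function.Injective ι) {A : Set X}
    (hA : IsZariskiClosed A) {η : C(K, ℝ)} (hη : ∀ k, ι k ∈ A → η k = 0) :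
    η ∈ closure (pullbackRegular ι '' {φ | ∀ x ∈ A, φ.1 x = 0}) := by
  have : T2Space X := t2Space_variety X
  have : T2Space K := T2Space.of_injective_continuous hι ι.continuous
  set J : Set (globalRegular X) := {φ | ∀ x ∈ A, φ.1 x = 0} with hJ
  have hdense : ∀ f : C(K, ℝ), f ∈ closure (Set.range (pullbackRegular ι)) := by
    intro f
    have hsep : (pullbackRegular ι).range.SeparatesPoints := by
      intro x y hxy
      obtain ⟨α, hα, hne⟩ := exists_regular_separating (hι.ne hxy)
      exact ⟨_, ⟨_, ⟨⟨α, mem_globalRegular.2 hα⟩, rfl⟩, rfl⟩, hne⟩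
    have := ContinuousMap.subalgebra_topologicalClosure_eq_top_of_separatesPoints _ hsep
    have hf : f ∈ (pullbackRegular ι).range.topologicalClosure := this ▸ Algebra.mem_top
    simpa [← SetLike.mem_coe, Subalgebra.topologicalClosure_coe] using hf
  -- the ideal generated by the regular functions vanishing on `A` lies in the closure
  have hideal : ∀ g ∈ Ideal.span (pullbackRegular ι '' J), g ∈ closure (pullbackRegular ι '' J) := by
    intro g hg
    have hadd : ∀ {a b : C(K, ℝ)}, a ∈ closure (pullbackRegular ι '' J) →
        b ∈ closure (pullbackRegular ι '' J) → a + b ∈ closure (pullbackRegular ι '' J) := by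
      intro a b ha hb
      refine map_mem_closure₂ continuous_add ha hb ?_
      rintro _ ⟨α, hα, rfl⟩ _ ⟨β, hβ, rfl⟩
      exact ⟨α + β, fun x hx => by simp [hα x hx, hβ x hx], map_add _ _ _⟩
    refine Submodule.span_induction (p := fun g _ => g ∈ closure (pullbackRegular ι '' J))
      (fun x hx => subset_closure hx) (subset_closure ⟨0, fun x _ => rfl, map_zero _⟩)
      (fun a b _ _ => hadd) (fun c a _ ha => ?_) hg
    refine map_mem_closure₂ continuous_mul (hdense c) ha ?_
    rintro _ ⟨γ, rfl⟩ _ ⟨α, hα, rfl⟩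
    exact ⟨γ * α, fun x hx => by simp [hα x hx], map_mul _ _ _⟩
  have hmem : η ∈ (Ideal.span (pullbackRegular ι '' J)).closure := by
    rw [← ContinuousMap.idealOfSet_ofIdeal_eq_closure, ContinuousMap.mem_idealOfSet]
    intro k hk
    refine hη k (by_contra fun hkA => hk ?_)
    obtain ⟨α, hα, h0, hne⟩ := exists_regular_vanishing hA hkA
    rw [ContinuousMap.mem_setOfIdeal]
    exact ⟨pullbackRegular ι ⟨α, mem_globalRegular.2 hα⟩,
      Ideal.subset_span ⟨⟨α, mem_globalRegular.2 hα⟩, h0, rfl⟩, hne⟩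
  have h2 : η ∈ closure ((Ideal.span (pullbackRegular ι '' J) : Ideal C(K, ℝ)) : Set C(K, ℝ)) := by
    simpa [← SetLike.mem_coe] using hmem
  exact closure_minimal hideal isClosed_closure h2

/-! ### Sprays on product bundles -/

/-- A map with values in `U` near a point, as a total map to the subtype `U`. -/
theorem exists_isMorphismAt_sub {X : Type u} {Y : Type v} {𝒳 : RingedFunctionSpace X}
    {𝒴 : RingedFunctionSpace Y} {f : X → Y} {x : X} (hf : IsMorphismAt 𝒳 𝒴 f x) {U : Set Y}
    (hU : IsOpen[𝒴.zariski] U) (hx : f x ∈ U) :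
    ∃ u : X → U, IsMorphismAt 𝒳 (𝒴.sub U) u x ∧ ∀ z, f z ∈ U → (u z).1 = f z := by
  classical
  refine ⟨fun z => if h : f z ∈ U then ⟨f z, h⟩ else ⟨f x, hx⟩, ?_, fun z hz => by simp [hz]⟩
  refine IsMorphismAt.codRestrict (hf.congr ?_)
  filter_upwards [hf.eventually_mem hU hx] with z hz
  simp [hz]

theorem Matrix.det_mem_of_entries {R : Type*} {A : Type*} [CommRing R] [CommRing A] [Algebra R A]
    (S : Subalgebra R A) {n : Type*} [Fintype n] [DecidableEq n] {M : Matrix n n A}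
    (h : ∀ i j, M i j ∈ S) : M.det ∈ S := by
  rw [Matrix.det_apply']
  exact sum_mem fun σ _ => mul_mem (intCast_mem S _) (prod_mem fun i _ => h _ _)

theorem Matrix.adjugate_mem_of_entries {R : Type*} {A : Type*} [CommRing R] [CommRing A]
    [Algebra R A] (S : Subalgebra R A) {n : Type*} [Fintype n] [DecidableEq n] {M : Matrix n n A}
    (h : ∀ i j, M i j ∈ S) (i j : n) : M.adjugate i j ∈ S := by
  rw [Matrix.adjugate_apply]
  refine Matrix.det_mem_of_entries S fun a b => ?_
  rw [Matrix.updateRow_apply]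
  split_ifs
  · by_cases hb : b = i
    · subst hb; simp
    · simp [hb]
  · exact h a b

/-- If the entries of an invertible matrix depend regularly on a parameter, then so do the entries
of the inverse matrix. -/
theorem inv_entry_mem_regularAt {X : Type u} {𝒳 : RingedFunctionSpace X} (hX : IsLocal 𝒳) {k : ℕ}
    {G : X → Matrix (Fin k) (Fin k) ℝ} {x : X}
    (hG : ∀ a b, (fun z => G z a b) ∈ 𝒳.regularAt x) (hdet : (G x).det ≠ 0) (a b : Fin k) :
    (fun z => (G z)⁻¹ a b) ∈ 𝒳.regularAt x := by
  set H : Matrix (Fin k) (Fin k) (X → ℝ) := Matrix.of fun a b z => G z a b with hH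
  have heval : ∀ z, (Pi.evalRingHom (fun _ : X => ℝ) z).mapMatrix H = G z := fun z => rfl
  have h1 : ∀ z, H.det z = (G z).det := fun z => by
    rw [← heval z, ← RingHom.map_det]; rfl
  have h2 : ∀ z, H.adjugate a b z = (G z).adjugate a b := fun z => by
    rw [← heval z, ← RingHom.map_adjugate]; rfl
  have h3 : H.det ∈ 𝒳.regularAt x := Matrix.det_mem_of_entries _ fun i j => hG i j
  have h4 : H.adjugate a b ∈ 𝒳.regularAt x := Matrix.adjugate_mem_of_entries _ (fun i j => hG i j) a b
  have h5 := mul_mem (hX x _ h3 (by rwa [h1])).2 h4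
  convert h5 using 1
  ext z
  simp [Matrix.inv_def, h1, h2]

/-- The Gram matrix of an injective real matrix is invertible. -/
theorem det_transpose_mul_self_ne_zero {m n : Type*} [Fintype m] [Fintype n] [DecidableEq n]
    (M : Matrix m n ℝ) (h : Function.Injective M.mulVec) : (M.transpose * M).det ≠ 0 := by
  have : IsUnit (M.transpose * M) := by
    rw [← Matrix.mulVec_injective_iff_isUnit]
    have h1 := Matrix.ker_mulVecLin_transpose_mul_self M
    have h2 : LinearMap.ker M.mulVecLin = ⊥ := LinearMap.ker_eq_bot.2 h
    rw [h2, LinearMap.ker_eq_bot] at h1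
    exact h1
  exact ((Matrix.isUnit_iff_isUnit_det _).1 this).ne_zero

theorem mulVec_mem_regularAt {X : Type u} {𝒳 : RingedFunctionSpace X} {m n : ℕ}
    {M : X → Matrix (Fin m) (Fin n) ℝ} {β : X → Fin n → ℝ} {x : X}
    (hM : ∀ a b, (fun z => M z a b) ∈ 𝒳.regularAt x) (hβ : ∀ b, (fun z => β z b) ∈ 𝒳.regularAt x)
    (a : Fin m) : (fun z => ((M z).mulVec (β z)) a) ∈ 𝒳.regularAt x := by
  have := sum_mem (t := Finset.univ) fun b _ => mul_mem (hM a b) (hβ b)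
  convert this using 1
  ext z
  simp [Matrix.mulVec, dotProduct]

section

variable {Y : Type v} [RealAlgebraicVariety Y]

/-- In a local trivialization, a map to the total space of a vector bundle is a morphism if its
base component and its fibre component are. -/
theorem isMorphismAt_total {X : Type u} {𝒳 : RingedFunctionSpace X} (hX : IsLocal 𝒳)
    {E : AlgebraicVectorBundle Y} {U : Set Y} {k : ℕ}
    {e : {w : E.Total | w.1 ∈ U} ≃ U × (Fin k → ℝ)}
    (he : ((ringed (X := E.Total)).sub _).IsIsomorphism
      (((ringed (X := Y)).sub U).prod (affineSpace k)) e)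
    {u : X → U} {c : X → Fin k → ℝ} {x : X} (hu : IsMorphismAt 𝒳 ((ringed (X := Y)).sub U) u x)
    (hc : ∀ a, (fun z => c z a) ∈ 𝒳.regularAt x) {G : X → E.Total}
    (hG : ∀ᶠ z in 𝒳.zariskiNhds x, G z = (e.symm (u z, c z)).1) :
    IsMorphismAt 𝒳 (ringed (X := E.Total)) G x :=
  (((isMorphismAt_subtypeVal _ _ _).comp (he.2.isMorphismAt _)).comp
    (IsMorphismAt.prodMk hX (f := fun z => (u z, c z)) hu (isMorphismAt_affineSpace hX hc))).congr hG

/-- `j v` is the orthogonal projection of `w ∈ ℝᴺ` to the image of `j`, that is, `w - j v` is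
orthogonal to this image. -/
def IsOrthProj {V : Type*} [AddCommGroup V] [Module ℝ V] {N : ℕ} (j : V →ₗ[ℝ] (Fin N → ℝ))
    (w : Fin N → ℝ) (v : V) : Prop :=
  ∀ v', j v' ⬝ᵥ (w - j v) = 0

theorem IsOrthProj.unique {V : Type*} [AddCommGroup V] [Module ℝ V] {N : ℕ}
    {j : V →ₗ[ℝ] (Fin N → ℝ)} (hj : Function.Injective j) {w : Fin N → ℝ} {v v' : V}
    (h : IsOrthProj j w v) (h' : IsOrthProj j w v') : v = v' := by
  have h1 := h (v - v')
  have h2 := h' (v - v')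
  have h3 : j (v - v') ⬝ᵥ j (v - v') = 0 := by
    have : j (v - v') = (w - j v') - (w - j v) := by rw [map_sub]; abel
    nth_rewrite 2 [this]
    rw [dotProduct_sub, h1, h2, sub_zero]
  have h4 := dotProduct_self_eq_zero.1 h3
  exact sub_eq_zero.1 (hj (by rw [h4, map_zero]))

/-- The orthogonal projection in terms of a matrix `M` of `j`, by the normal equations. -/
theorem isOrthProj_of_matrix {V : Type*} [AddCommGroup V] [Module ℝ V] {N k : ℕ}
    {j : V →ₗ[ℝ] (Fin N → ℝ)} (hj : Function.Injective j) (L : V ≃ₗ[ℝ] (Fin k → ℝ))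
    {M : Matrix (Fin N) (Fin k) ℝ} (hM : M = LinearMap.toMatrix' (j ∘ₗ L.symm.toLinearMap)) :
    (M.transpose * M).det ≠ 0 ∧ ∀ w, IsOrthProj j w
      (L.symm ((M.transpose * M)⁻¹.mulVec (M.transpose.mulVec w))) := by
  have hMv : ∀ c, M.mulVec c = j (L.symm c) := fun c => by
    rw [hM, LinearMap.toMatrix'_mulVec]; rfl
  have hdet : (M.transpose * M).det ≠ 0 := by
    refine det_transpose_mul_self_ne_zero M fun a b hab => ?_
    simp only [hMv] at hab
    exact L.symm.injective (hj hab)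
  refine ⟨hdet, fun w v' => ?_⟩
  have h1 : j v' = M.mulVec (L v') := by rw [hMv, L.symm_apply_apply]
  rw [← hMv, h1, dotProduct_comm, Matrix.dotProduct_mulVec, ← Matrix.mulVec_transpose,
    Matrix.mulVec_sub, Matrix.mulVec_mulVec, Matrix.mulVec_mulVec,
    Matrix.mul_nonsing_inv _ (isUnit_iff_ne_zero.2 hdet), Matrix.one_mulVec, sub_self,
    zero_dotProduct]

/-- A dominating spray can be replaced by a dominating spray on a product bundle `Y × ℝᴺ`: the
bundle of the spray embeds into such a bundle, and the orthogonal projection onto it is regular. -/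
theorem exists_spray_product (h : IsMalleable Y) :
    ∃ (N : ℕ) (s : Y × (Fin N → ℝ) → Y),
      IsMorphism ((ringed (X := Y)).prod (affineSpace N)) (ringed (X := Y)) s ∧
        (∀ y, s (y, 0) = y) ∧ ∀ y, IsSubmersionAtZero (fun w => s (y, w)) y := by
  obtain ⟨⟨E, s, hs0⟩, hdom⟩ := h
  obtain ⟨N, j, hj, hjm⟩ := E.exists_injective
  have key : ∀ y₀ : Y, ∃ U : Set Y, y₀ ∈ U ∧ IsOpen[(ringed (X := Y)).zariski] U ∧
      ∃ (k : ℕ) (e : {w : E.Total | w.1 ∈ U} ≃ U × (Fin k → ℝ)),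
      ((ringed (X := E.Total)).sub _).IsIsomorphism
        (((ringed (X := Y)).sub U).prod (affineSpace k)) e ∧
      ∃ C : U → Matrix (Fin k) (Fin N) ℝ,
        (∀ u a b, (fun z => C z a b) ∈ ((ringed (X := Y)).sub U).regularAt u) ∧
        ∀ (u : U) w, ∃ v : E.Fiber u,
          e.symm (u, (C u).mulVec w) = ⟨⟨u, v⟩, u.2⟩ ∧ IsOrthProj (j u) w v := by
    intro y₀
    obtain ⟨U, hy, hU, k, e, he, hL⟩ := E.locally_trivial y₀
    choose L hL using hL
    have hsymm : ∀ (u : U) (c : Fin k → ℝ),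
        e.symm (u, c) = ⟨⟨u, (L u).symm c⟩, u.2⟩ := fun u c => by
      rw [Equiv.symm_apply_eq, hL, LinearEquiv.apply_symm_apply]
    have hloc : IsLocal ((ringed (X := Y)).sub U) := isLocal_sub (isLocal_ringed Y) U
    set M : U → Matrix (Fin N) (Fin k) ℝ :=
      fun u => LinearMap.toMatrix' (j u ∘ₗ (L u).symm.toLinearMap) with hM
    have hMreg : ∀ u a b, (fun z => M z a b) ∈ ((ringed (X := Y)).sub U).regularAt u := by
      intro u a b
      have h1 : IsMorphismAt ((ringed (X := Y)).sub U) (ringed (X := E.Total))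
          (fun z => (e.symm (z, Pi.single b 1)).1) u :=
        isMorphismAt_total hloc he (isMorphismAt_id _ u)
          (c := fun _ => Pi.single b 1) (fun i => Subalgebra.algebraMap_mem _ _)
          (Filter.Eventually.of_forall fun z => rfl)
      have h2 := ((isMorphismAt_snd _ _ _).comp ((hjm.isMorphismAt _).comp h1)).coord_mem_regularAt a
      convert h2 using 1
      ext z
      simp only [Function.comp, hM, LinearMap.toMatrix'_apply]
      exact (congrArg (fun w : {w : E.Total | w.1 ∈ U} => j w.1.1 w.1.2 a) (hsymm z _)).symm
    refine ⟨U, hy, hU, k, e, he, fun u => ((M u).transpose * M u)⁻¹ * (M u).transpose, ?_, ?_⟩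
    · intro u a b
      have hdet := (isOrthProj_of_matrix (hj u) (L u) (M := M u) rfl).1
      have hG : ∀ a b, (fun z => ((M z).transpose * M z) a b) ∈
          ((ringed (X := Y)).sub U).regularAt u := by
        intro a b
        have := sum_mem (t := Finset.univ) fun i _ => mul_mem (hMreg u i a) (hMreg u i b)
        convert this using 1
        ext z
        simp [Matrix.mul_apply]
      have := sum_mem (t := Finset.univ) fun i _ =>
        mul_mem (inv_entry_mem_regularAt hloc hG hdet a i) (hMreg u b i)
      convert this using 1
      ext z
      simp [Matrix.mul_apply]
    · intro u w
      refine ⟨_, hsymm u _, ?_⟩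
      rw [← Matrix.mulVec_mulVec]
      exact (isOrthProj_of_matrix (hj u) (L u) (M := M u) rfl).2 w
  have hP : ∀ (y : Y) (w : Fin N → ℝ), ∃ v, IsOrthProj (j y) w v := by
    intro y w
    obtain ⟨U, hy, -, k, e, -, C, -, h⟩ := key y
    obtain ⟨v, -, hv⟩ := h ⟨y, hy⟩ w
    exact ⟨v, hv⟩
  choose P hP using hP
  have hPj : ∀ y v, P y (j y v) = v := fun y v =>
    (hP y (j y v)).unique (hj y) fun v' => by simp
  refine ⟨N, fun z => s ⟨z.1, P z.1 z.2⟩, ?_, ?_, ?_⟩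
  · refine isMorphism_iff.2 fun z₀ => ?_
    refine IsMorphismAt.comp (s.isMorphism.isMorphismAt _)
      (f := fun z : Y × (Fin N → ℝ) => (⟨z.1, P z.1 z.2⟩ : E.Total)) ?_
    obtain ⟨U, hy, hU, k, e, he, C, hC, h⟩ := key z₀.1
    have hloc := isLocal_prod (ringed (X := Y)) (affineSpace N)
    obtain ⟨u, hu, huU⟩ :=
      exists_isMorphismAt_sub (isMorphismAt_fst (ringed (X := Y)) (affineSpace N) z₀) hU hy
    refine isMorphismAt_total hloc he hu (c := fun z => (C (u z)).mulVec z.2) (fun a => ?_) ?_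
    · exact mulVec_mem_regularAt (fun a b => hu.2 _ (hC _ a b))
        (fun b => (isMorphismAt_snd _ _ _).coord_mem_regularAt b) a
    · filter_upwards [(isMorphismAt_fst (ringed (X := Y)) (affineSpace N) z₀).eventually_mem hU hy]
        with z hz
      have huz := huU z hz
      obtain ⟨v, h1, h2⟩ := h (u z) z.2
      rw [h1]
      have : ∀ (y : Y), y = z.1 → ∀ v : E.Fiber y, IsOrthProj (j y) z.2 v →
          (⟨z.1, P z.1 z.2⟩ : E.Total) = ⟨y, v⟩ := by
        rintro y rfl v hv
        rw [(hP _ _).unique (hj _) hv]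
      exact this _ huz v h2
  · intro y
    have := hPj y 0
    rw [map_zero] at this
    simp only [this]
    exact hs0 y
  · intro y
    refine ⟨?_, fun δ hδ => ?_⟩
    · have := hPj y 0
      rw [map_zero] at this
      simp only [this]
      exact hs0 y
    · obtain ⟨v, hv⟩ := (hdom y).2 δ hδ
      refine ⟨j y v, fun φ => ?_⟩
      have := hv φ
      simpa only [← map_smul, hPj] using this

end

/-! ### Local sections of submersions -/

/-- A function on `E` whose derivative at a point is injective is injective near this point. -/
theorem HasStrictFDerivAt.exists_injOn {E F : Type*} [NormedAddCommGroup E] [NormedSpace ℝ E]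
    [FiniteDimensional ℝ E] [NormedAddCommGroup F] [NormedSpace ℝ F] [FiniteDimensional ℝ F]
    {f : E → F} {f' : E →L[ℝ] F} {x : E} (hf : HasStrictFDerivAt f f' x)
    (h : Function.Injective f') : ∃ s ∈ 𝓝 x, Set.InjOn f s := by
  have : CompleteSpace E := FiniteDimensional.complete ℝ E
  obtain ⟨g, hg⟩ := LinearMap.exists_leftInverse_of_injective (f' : E →ₗ[ℝ] F)
    (LinearMap.ker_eq_bot.2 h)
  have h1 : HasStrictFDerivAt (g.toContinuousLinearMap ∘ f)
      ((ContinuousLinearEquiv.refl ℝ E : E ≃L[ℝ] E) : E →L[ℝ] E) x := by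
    convert! g.toContinuousLinearMap.hasStrictFDerivAt.comp x hf using 1
    ext v
    exact (LinearMap.congr_fun hg v).symm
  refine ⟨_, (h1.toOpenPartialHomeomorph _).open_source.mem_nhds
    h1.mem_toOpenPartialHomeomorph_source, fun a ha b hb hab => ?_⟩
  exact (h1.toOpenPartialHomeomorph _).injOn ha hb (congrArg g.toContinuousLinearMap hab)

/-- Every vector in the kernel of a surjective derivative is tangent to a curve in the level
set. -/
theorem HasStrictFDerivAt.exists_curve {E F : Type*} [NormedAddCommGroup E] [NormedSpace ℝ E]
    [FiniteDimensional ℝ E] [NormedAddCommGroup F] [NormedSpace ℝ F] [FiniteDimensional ℝ F]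
    {f : E → F} {f' : E →L[ℝ] F} {x : E} (hf : HasStrictFDerivAt f f' x)
    (h : Function.Surjective f') {w : E} (hw : f' w = 0) :
    ∃ γ : ℝ → E, γ 0 = x ∧ HasDerivAt γ w 0 ∧ ∀ᶠ t in 𝓝 0, f (γ t) = f x := by
  have : CompleteSpace E := FiniteDimensional.complete ℝ E
  have hr : f'.range = ⊤ := LinearMap.range_eq_top.2 h
  let l : ℝ →L[ℝ] f'.ker := ContinuousLinearMap.toSpanSingleton ℝ (⟨w, hw⟩ : f'.ker)
  have hl : l 0 = 0 := map_zero l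
  refine ⟨fun t => hf.implicitFunction f f' hr (f x) (l t), ?_, ?_, ?_⟩
  · simp only [hl]
    exact hf.implicitFunction_apply_image hr
  · have h1 := hf.to_implicitFunction hr
    rw [← hl] at h1
    have h2 := (h1.hasFDerivAt.comp (0 : ℝ) l.hasFDerivAt).hasDerivAt
    have h3 : (f'.ker.subtypeL.comp l) 1 = w := by simp [l]
    rw [h3] at h2
    exact h2
  · have h1 := hf.map_implicitFunction_eq hr
    have h2 : Filter.Tendsto (fun t : ℝ => (f x, l t)) (𝓝 0) (𝓝 (f x, 0)) := by
      refine tendsto_const_nhds.prodMk_nhds ?_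
      rw [← hl]
      exact l.continuous.tendsto 0
    exact h2.eventually h1

/-- Let `Z` be contained in the zero set of `P`, and let `S (z, v)` be a family of maps to `Z`,
parametrized by `z ∈ Z`, with `S (z, 0) = z`, whose differential in `v` at `(z₀, 0)` is onto the
kernel of the differential of `P`.  Then the equation `S (z, v) = z'` has a solution
`v = τ (z, z')` which depends continuously on `z, z' ∈ Z` near `z₀` and vanishes for `z = z'`. -/
theorem exists_local_section {E V F : Type*} [NormedAddCommGroup E] [NormedSpace ℝ E]
    [FiniteDimensional ℝ E] [NormedAddCommGroup F] [NormedSpace ℝ F] [FiniteDimensional ℝ F]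
    [NormedAddCommGroup V] [NormedSpace ℝ V] {Z : Set E} {z₀ : E} (hz₀ : z₀ ∈ Z)
    {P : E → F} {P' : E →L[ℝ] F} (hP : HasStrictFDerivAt P P' z₀) (hPZ : ∀ z ∈ Z, P z = 0)
    {S : E × V → E} {S' : E × V →L[ℝ] E} (hS : HasStrictFDerivAt S S' (z₀, 0))
    (hS0 : ∀ᶠ z in 𝓝 z₀, z ∈ Z → S (z, 0) = z)
    (hSZ : ∀ᶠ p in 𝓝 ((z₀, 0) : E × V), p.1 ∈ Z → S p ∈ Z)
    (hdom : ∀ w, P' w = 0 → ∃ v, S' (0, v) = w) {B : Set (E × V)} (hB : B ∈ 𝓝 (z₀, (0 : V))) :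
    ∃ O : Set E, IsOpen O ∧ z₀ ∈ O ∧ ∃ τ : E × E → V,
      ContinuousOn τ (O ×ˢ O) ∧ (∀ z ∈ Z ∩ O, τ (z, z) = 0) ∧
      ∀ z ∈ Z ∩ O, ∀ z' ∈ Z ∩ O, (z, τ (z, z')) ∈ B ∧ S (z, τ (z, z')) = z' := by
  have : CompleteSpace E := FiniteDimensional.complete ℝ E
  have hSz : S (z₀, 0) = z₀ := hS0.self_of_nhds hz₀
  obtain ⟨Q, hQ⟩ := Submodule.ClosedComplemented.of_finiteDimensional (P'.ker)
  -- near `z₀`, a point of `Z` is determined by its image under the projection `Q`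
  obtain ⟨I, hI, hinj⟩ : ∃ s ∈ 𝓝 z₀, Set.InjOn (fun z => (P z, Q z)) s := by
    refine (hP.prodMk Q.hasStrictFDerivAt).exists_injOn ?_
    refine (injective_iff_map_eq_zero _).2 fun v hv => ?_
    have h1 : P' v = 0 := congrArg Prod.fst hv
    have h2 : Q v = 0 := congrArg Prod.snd hv
    have h3 := hQ ⟨v, h1⟩
    rw [h2] at h3
    exact (congrArg Subtype.val h3).symm
  have hsurj : Function.Surjective
      (Q.comp (S'.comp (ContinuousLinearMap.inr ℝ E V)) : V →ₗ[ℝ] P'.ker) := by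
    intro w
    obtain ⟨v, hv⟩ := hdom w w.2
    exact ⟨v, by simp [hv, hQ]⟩
  obtain ⟨R₀, hR₀⟩ := LinearMap.exists_rightInverse_of_surjective _ (LinearMap.range_eq_top.2 hsurj)
  set R : P'.ker →L[ℝ] V := R₀.toContinuousLinearMap with hRdef
  have hR : ∀ t, Q (S' (0, R t)) = t := fun t =>
    LinearMap.congr_fun hR₀ t
  let G : E × P'.ker → E × P'.ker := fun p => (p.1, Q (S (p.1, R p.2)))
  let m : E × P'.ker →L[ℝ] E × V :=
    (ContinuousLinearMap.fst ℝ E P'.ker).prod (R.comp (ContinuousLinearMap.snd ℝ E P'.ker))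
  let G₀ : E × P'.ker →L[ℝ] E × P'.ker :=
    (ContinuousLinearMap.fst ℝ E P'.ker).prod (Q.comp (S'.comp m))
  have hG₀ : Function.Injective (G₀ : E × P'.ker →ₗ[ℝ] E × P'.ker) := by
    refine (injective_iff_map_eq_zero _).2 ?_
    rintro ⟨z, t⟩ h
    have h1 : z = 0 := congrArg Prod.fst h
    have h2 : Q (S' (z, R t)) = 0 := congrArg Prod.snd h
    subst h1
    rw [hR] at h2
    rw [h2]; rfl
  let G' : (E × P'.ker) ≃L[ℝ] E × P'.ker :=
    (LinearEquiv.ofInjectiveEndo _ hG₀).toContinuousLinearEquiv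
  have hm : m (z₀, 0) = (z₀, 0) := by simp [m]
  have hG : HasStrictFDerivAt G (G' : E × P'.ker →L[ℝ] E × P'.ker) (z₀, 0) := by
    have h1 : HasStrictFDerivAt G G₀ (z₀, 0) := by
      refine hasStrictFDerivAt_fst.prodMk ?_
      refine Q.hasStrictFDerivAt.comp _ (HasStrictFDerivAt.comp (g := S) _ ?_ m.hasStrictFDerivAt)
      change HasStrictFDerivAt S S' (m (z₀, 0))
      rwa [hm]
    convert h1 using 1
    ext v <;> rfl
  set Φ := hG.toOpenPartialHomeomorph G with hΦ
  have hΦG : ∀ p, Φ p = G p := fun p => rfl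
  have hsrc : ((z₀, 0) : E × P'.ker) ∈ Φ.source := hG.mem_toOpenPartialHomeomorph_source
  have hGz : ∀ z, S (z, 0) = z → G (z, 0) = (z, Q z) := fun z hz => by simp [G, hz]
  have htgt : (z₀, Q z₀) ∈ Φ.target := by
    have := Φ.map_source hsrc
    rwa [hΦG, hGz z₀ hSz] at this
  have hinv : ∀ z, (z, 0) ∈ Φ.source → S (z, 0) = z → Φ.symm (z, Q z) = (z, 0) := by
    intro z h1 h2
    rw [← hGz z h2, ← hΦG, Φ.left_inv h1]
  let q : E × E → E × P'.ker := fun p => (p.1, Q p.2)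
  have hq : Continuous q := by fun_prop
  let τ : E × E → V := fun p => R (Φ.symm (q p)).2
  have hΨ : Filter.Tendsto (fun p => m (Φ.symm (q p))) (𝓝 (z₀, z₀)) (𝓝 (z₀, 0)) := by
    have h1 : ContinuousAt (fun p => m (Φ.symm (q p))) (z₀, z₀) :=
      m.continuous.continuousAt.comp
        (ContinuousAt.comp (f := q) (g := Φ.symm) (Φ.continuousAt_symm htgt) hq.continuousAt)
    have h2 : m (Φ.symm (q (z₀, z₀))) = (z₀, 0) := by
      change m (Φ.symm (z₀, Q z₀)) = _
      rw [hinv z₀ hsrc hSz, hm]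
    simpa only [ContinuousAt, h2] using h1
  have e1 : ∀ᶠ p in 𝓝 (z₀, z₀), q p ∈ Φ.target :=
    hq.continuousAt.preimage_mem_nhds (Φ.open_target.mem_nhds htgt)
  have e2 : ∀ᶠ p in 𝓝 (z₀, z₀), m (Φ.symm (q p)) ∈ B := hΨ hB
  have e3 : ∀ᶠ p in 𝓝 (z₀, z₀), (m (Φ.symm (q p))).1 ∈ Z → S (m (Φ.symm (q p))) ∈ Z :=
    hΨ.eventually hSZ
  have e4 : ∀ᶠ p in 𝓝 (z₀, z₀), S (m (Φ.symm (q p))) ∈ I := by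
    have h1 : ContinuousAt S (z₀, 0) := hS.continuousAt
    exact hΨ.eventually (h1.preimage_mem_nhds (by rwa [hSz]))
  obtain ⟨O₁, hO₁, h1, O₂, hO₂, h2, hO⟩ : ∃ u, IsOpen u ∧ z₀ ∈ u ∧ ∃ v, IsOpen v ∧ z₀ ∈ v ∧
      ∀ p ∈ u ×ˢ v, q p ∈ Φ.target ∧ m (Φ.symm (q p)) ∈ B ∧
        ((m (Φ.symm (q p))).1 ∈ Z → S (m (Φ.symm (q p))) ∈ Z) ∧ S (m (Φ.symm (q p))) ∈ I := by
    have := e1.and (e2.and (e3.and e4))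
    obtain ⟨u, v, hu, hu', hv, hv', h⟩ := mem_nhds_prod_iff'.1 this
    exact ⟨u, hu, hu', v, hv, hv', fun p hp => h hp⟩
  have e5 : ∀ᶠ z in 𝓝 z₀, (z ∈ Z → S (z, 0) = z) ∧ z ∈ I ∧ ((z, 0) : E × P'.ker) ∈ Φ.source := by
    refine hS0.and (Filter.Eventually.and hI ?_)
    have : Continuous fun z : E => ((z, 0) : E × P'.ker) := by fun_prop
    exact this.continuousAt.preimage_mem_nhds (Φ.open_source.mem_nhds hsrc)
  obtain ⟨O₃, hO₃, ho₃, h3⟩ := eventually_nhds_iff.1 e5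
  refine ⟨O₁ ∩ O₂ ∩ O₃, (hO₁.inter hO₂).inter ho₃, ⟨⟨h1, h2⟩, h3⟩, τ, ?_, ?_, ?_⟩
  · intro p hp
    have ht := (hO p ⟨hp.1.1.1, hp.2.1.2⟩).1
    refine ContinuousAt.continuousWithinAt ?_
    have h4 := ContinuousAt.comp (f := q) (g := Φ.symm) (Φ.continuousAt_symm ht) hq.continuousAt
    exact R.continuous.continuousAt.comp (continuous_snd.continuousAt.comp h4)
  · intro z hz
    obtain ⟨h4, h5, h6⟩ := hO₃ z hz.2.2
    change R (Φ.symm (z, Q z)).2 = 0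
    rw [hinv z h6 (h4 hz.1), map_zero]
  · intro z hz z' hz'
    obtain ⟨ht, hb, hZ, hi⟩ := hO (z, z') ⟨hz.2.1.1, hz'.2.1.2⟩
    have hr : G (Φ.symm (z, Q z')) = (z, Q z') := Φ.right_inv ht
    have hz1 : (Φ.symm (z, Q z')).1 = z := congrArg Prod.fst hr
    have hmz : m (Φ.symm (q (z, z'))) = (z, τ (z, z')) := Prod.ext hz1 rfl
    have hQS : Q (S (m (Φ.symm (q (z, z'))))) = Q z' := congrArg Prod.snd hr
    rw [hmz] at hb hZ hi hQS
    refine ⟨hb, hinj hi (hO₃ z' hz'.2.2).2.1 ?_⟩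
    simp only [hQS, hPZ _ (hZ hz.1), hPZ z' hz'.1]

/-! ### Polynomial maps -/

/-- The differential of a polynomial function. -/
noncomputable def MvPolynomial.evalFDeriv {n : ℕ} (Q : MvPolynomial (Fin n) ℝ) (z : Fin n → ℝ) :
    (Fin n → ℝ) →L[ℝ] ℝ :=
  ∑ j, MvPolynomial.eval z (MvPolynomial.pderiv j Q) • ContinuousLinearMap.proj j

theorem MvPolynomial.hasStrictFDerivAt_eval {n : ℕ} (Q : MvPolynomial (Fin n) ℝ) (z : Fin n → ℝ) :
    HasStrictFDerivAt (fun z => MvPolynomial.eval z Q) (Q.evalFDeriv z) z := by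
  induction Q using MvPolynomial.induction_on with
  | C r =>
    simp only [MvPolynomial.eval_C]
    have h0 : (MvPolynomial.C r : MvPolynomial (Fin n) ℝ).evalFDeriv z = 0 := by
      simp [MvPolynomial.evalFDeriv]
    rw [h0]
    exact hasStrictFDerivAt_const r z
  | add p q hp hq =>
    simp only [map_add]
    convert! hp.add hq using 1
    simp [MvPolynomial.evalFDeriv, add_smul, Finset.sum_add_distrib]
  | mul_X p i hp =>
    simp only [map_mul, MvPolynomial.eval_X]
    convert! hp.mul (hasStrictFDerivAt_apply i z) using 1
    ext v
    simp only [evalFDeriv, Derivation.leibniz, pderiv_X, Pi.single_apply, smul_eq_mul, map_add,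
      map_mul, eval_X, apply_ite, map_zero, sum_apply, smul_apply, ContinuousLinearMap.proj_apply,
      mul_one, mul_zero, add_mul, ite_mul, zero_mul, Finset.sum_add_distrib, Finset.sum_ite_eq,
      Finset.mem_univ, if_true, add_apply, Finset.mul_sum, mul_assoc]

theorem MvPolynomial.surjective_evalFDeriv_pi {n c : ℕ} {P : Fin c → MvPolynomial (Fin n) ℝ}
    {z : Fin n → ℝ}
    (h : LinearIndependent ℝ fun (i : Fin c) (j : Fin n) =>
      MvPolynomial.eval z (MvPolynomial.pderiv j (P i))) :
    Function.Surjective (ContinuousLinearMap.pi fun i => (P i).evalFDeriv z) := by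
  set M : Matrix (Fin c) (Fin n) ℝ :=
    Matrix.of fun i j => MvPolynomial.eval z (MvPolynomial.pderiv j (P i)) with hM
  have h1 : M.rank = Fintype.card (Fin c) := LinearIndependent.rank_matrix h
  have h2 : LinearMap.range M.mulVecLin = ⊤ :=
    Submodule.eq_top_of_finrank_eq (by rw [← Matrix.rank, h1]; simp)
  intro w
  obtain ⟨v, hv⟩ := LinearMap.range_eq_top.1 h2 w
  refine ⟨v, ?_⟩
  rw [← hv]
  ext i
  simp [MvPolynomial.evalFDeriv, hM, Matrix.mulVec, dotProduct]

/-! ### Local inversion of a dominating spray -/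

theorem mem_regularAt_of_comp_subtypeVal {X : Type u} {𝒳 : RingedFunctionSpace X} {U : Set X}
    (hU : IsOpen[𝒳.zariski] U) {φ : X → ℝ} (x : U)
    (h : φ ∘ Subtype.val ∈ (𝒳.sub U).regularAt x) : φ ∈ 𝒳.regularAt x := by
  obtain ⟨g, hg, H⟩ := h
  refine 𝒳.regularAt_congr x _ _ hg ?_
  let := 𝒳.zariski
  have H' : ∀ᶠ z : U in 𝓝 x, φ z = g z := H
  rw [nhds_subtype_eq_comap, Filter.eventually_comap] at H'
  filter_upwards [H', hU.mem_nhds x.2] with z h1 h2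
  exact h1 ⟨z, h2⟩ rfl

theorem isOpen_of_isOpen_affineZariski {n : ℕ} {W : Set (Fin n → ℝ)}
    (h : IsOpen[(affineSpace n).zariski] W) : IsOpen W := by
  have hc : Continuous[_, affineZariski n] (id : (Fin n → ℝ) → Fin n → ℝ) := by
    refine continuous_generateFrom_iff.2 ?_
    rintro _ ⟨Q, rfl⟩
    exact isOpen_ne_fun (MvPolynomial.continuous_eval Q) continuous_const
  exact @IsOpen.preimage _ _ _ (affineZariski n) _ hc _ h

/-- Linear maps are morphisms from the ringed space of smooth functions to affine space. -/
theorem isMorphismAt_smoothSpace_affineSpace {V : Type u} [NormedAddCommGroup V] [NormedSpace ℝ V]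
    {T : Set V} {n : ℕ} (l : V →L[ℝ] (Fin n → ℝ)) (x : T) :
    IsMorphismAt (smoothSpace T) (affineSpace n) (fun z => l z.1) x :=
  isMorphismAt_affineSpace (isLocal_smoothSpace T) fun i =>
    ⟨fun z => l z i, (contDiff_pi.1 l.contDiff i).contDiffAt,
      Filter.Eventually.of_forall fun _ => rfl⟩

/-- If `ρ` is a morphism from a subset `Z` of `ℝⁿ` to `Y`, then every curve `γ` in `Z` defines a
tangent vector to `Y` at `ρ (γ 0)`. -/
theorem exists_tangentVector_of_curve {Y : Type v} [RealAlgebraicVariety Y] {n : ℕ}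
    {Z : Set (Fin n → ℝ)} {ρ : Z → Y} {z₀ : Z}
    (hρ : IsMorphismAt (smoothSpace Z) (ringed (X := Y)) ρ z₀) {γ : ℝ → Fin n → ℝ}
    {w : Fin n → ℝ} (hγ0 : γ 0 = z₀) (hγ : HasDerivAt γ w 0) (hγZ : ∀ᶠ t in 𝓝 0, γ t ∈ Z) :
    ∃ δ : (ringed (X := Y)).regularAt (ρ z₀) →ₗ[ℝ] ℝ, IsTangentVector (ρ z₀) δ ∧
      ∀ φ (i : Fin n), (∀ z, φ.1 (ρ z) = z.1 i) → δ φ = w i := by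
  classical
  let γ' : ℝ → Y := fun t => if h : γ t ∈ Z then ρ ⟨γ t, h⟩ else ρ z₀
  have hγ'0 : γ' 0 = ρ z₀ := by
    have : γ 0 ∈ Z := hγ0 ▸ z₀.2
    simp only [γ', this, dif_pos]
    congr 1
    exact Subtype.ext hγ0
  have hdiff : ∀ φ : (ringed (X := Y)).regularAt (ρ z₀),
      DifferentiableAt ℝ (fun t => φ.1 (γ' t)) 0 := by
    intro φ
    obtain ⟨g, hg, H⟩ := hρ.2 φ.1 φ.2
    have H' : ∀ᶠ z : Z in 𝓝 z₀, (φ.1 ∘ ρ) z = g z := H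
    rw [nhds_subtype_eq_comap, Filter.eventually_comap] at H'
    have hg' : DifferentiableAt ℝ g (γ 0) := hγ0 ▸ hg.differentiableAt one_ne_zero
    have hc : Filter.Tendsto γ (𝓝 0) (𝓝 z₀) := hγ0 ▸ hγ.continuousAt
    refine (hg'.comp (0 : ℝ) hγ.differentiableAt).congr_of_eventuallyEq ?_
    filter_upwards [hγZ, hc.eventually H'] with t h1 h2
    simpa [γ', h1] using h2 ⟨γ t, h1⟩ rfl
  refine ⟨{ toFun := fun φ => deriv (fun t => φ.1 (γ' t)) 0
            map_add' := fun φ ψ => deriv_add (hdiff φ) (hdiff ψ)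
            map_smul' := fun c φ => deriv_const_mul c (hdiff φ) }, fun φ ψ => ?_, fun φ i h => ?_⟩
  · have := deriv_mul (hdiff φ) (hdiff ψ)
    rw [hγ'0] at this
    refine this.trans ?_
    change deriv (fun t => φ.1 (γ' t)) 0 * ψ.1 (ρ z₀) + φ.1 (ρ z₀) * deriv (fun t => ψ.1 (γ' t)) 0 =
      φ.1 (ρ z₀) * deriv (fun t => ψ.1 (γ' t)) 0 + ψ.1 (ρ z₀) * deriv (fun t => φ.1 (γ' t)) 0
    ring
  · have h1 : (fun t => φ.1 (γ' t)) =ᶠ[𝓝 0] fun t => γ t i := by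
      filter_upwards [hγZ] with t ht
      simp [γ', ht, h]
    exact h1.deriv_eq.trans (hasDerivAt_pi.1 hγ i).deriv

/-- Near a nonsingular point, the equation `s (y, v) = y'` has a continuous solution
`v = τ (y, y')` with `τ (y, y) = 0`.  Here `Y` is locally the zero set of polynomials with
independent gradients, along which every vector in the kernel of the differential is tangent to a
curve and so, by domination, lies in the image of the differential of `s (y₀, ·)`. -/
theorem exists_local_inverse_spray {Y : Type v} [RealAlgebraicVariety Y] {y₀ : Y}
    (hns : IsNonsingularPoint y₀) {N : ℕ} {s : Y × (Fin N → ℝ) → Y}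
    (hs : IsMorphism ((ringed (X := Y)).prod (affineSpace N)) (ringed (X := Y)) s)
    (hs0 : ∀ y, s (y, 0) = y) (hsub : IsSubmersionAtZero (fun w => s (y₀, w)) y₀) :
    ∃ W ∈ 𝓝 y₀, ∃ τ : Y × Y → Fin N → ℝ, ContinuousOn τ (W ×ˢ W) ∧ (∀ y ∈ W, τ (y, y) = 0) ∧
      ∀ y ∈ W, ∀ y' ∈ W, s (y, τ (y, y')) = y' := by
  classical
  obtain ⟨U, hy, hU, n, c, P, W, hW, h⟩ := hns
  let Z : Set (Fin n → ℝ) := {x | x ∈ W ∧ ∀ i, MvPolynomial.eval x (P i) = 0}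
  obtain ⟨e, he, hind⟩ : ∃ e : U ≃ Z,
      ((ringed (X := Y)).sub U).IsIsomorphism ((affineSpace n).sub Z) e ∧
        LinearIndependent ℝ fun (i : Fin c) (j : Fin n) =>
          MvPolynomial.eval (e ⟨y₀, hy⟩).1 (MvPolynomial.pderiv j (P i)) := h
  set z₀ : Z := e ⟨y₀, hy⟩ with hz₀
  let ρ : Z → Y := fun z => (e.symm z).1
  let χ : Y → Fin n → ℝ := fun y => if h : y ∈ U then (e ⟨y, h⟩).1 else 0
  have hχU : ∀ y (h : y ∈ U), χ y = (e ⟨y, h⟩).1 := fun y h => by simp [χ, h]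
  have hχZ : ∀ y ∈ U, χ y ∈ Z := fun y h => by rw [hχU y h]; exact (e ⟨y, h⟩).2
  have hρU : ∀ z, ρ z ∈ U := fun z => (e.symm z).2
  have hχρ : ∀ z, χ (ρ z) = z.1 := fun z => by
    rw [hχU _ (hρU z)]
    simp [ρ]
  have hρχ : ∀ y (h : y ∈ U), ρ ⟨χ y, hχZ y h⟩ = y := fun y h => by
    have : (⟨χ y, hχZ y h⟩ : Z) = e ⟨y, h⟩ := Subtype.ext (hχU y h)
    simp [ρ, this]
  have hχinj : ∀ y ∈ U, ∀ y' ∈ U, χ y = χ y' → y = y' := fun y h y' h' hyy => by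
    rw [← hρχ y h, ← hρχ y' h']
    congr 1
    exact Subtype.ext hyy
  have hρz₀ : ρ z₀ = y₀ := by simp [ρ, hz₀]
  have hχy₀ : χ y₀ = z₀ := hχU y₀ hy
  have hχreg : ∀ y ∈ U, ∀ i, (fun y => χ y i) ∈ (ringed (X := Y)).regularAt y := by
    intro y h i
    refine mem_regularAt_of_comp_subtypeVal hU ⟨y, h⟩ ?_
    have h1 := ((isMorphismAt_subtypeVal (affineSpace n) Z _).comp
      (he.1.isMorphismAt ⟨y, h⟩)).coord_mem_regularAt i
    convert h1 using 1
    ext u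
    exact congrFun (hχU u.1 u.2) i
  have hρmor : ∀ z, IsMorphismAt ((affineSpace n).sub Z) (ringed (X := Y)) ρ z := fun z =>
    (isMorphismAt_subtypeVal _ _ _).comp (he.2.isMorphismAt z)
  -- the spray in the local coordinates of `Y`
  let T : Set ((Fin n → ℝ) × (Fin N → ℝ)) := {p | p.1 ∈ Z}
  let σ : T → Y := fun p => s (ρ ⟨p.1.1, p.2⟩, p.1.2)
  have hσ : ∀ p, IsMorphismAt (smoothSpace T) (ringed (X := Y)) σ p := by
    intro p
    refine IsMorphismAt.comp (hs.isMorphismAt _) (IsMorphismAt.prodMk (isLocal_smoothSpace T)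
      (f := fun p : T => (ρ ⟨p.1.1, p.2⟩, p.1.2)) ?_ ?_)
    · refine IsMorphismAt.comp (hρmor _) (f := fun p : T => (⟨p.1.1, p.2⟩ : Z)) ?_
      exact IsMorphismAt.codRestrict
        (isMorphismAt_smoothSpace_affineSpace (ContinuousLinearMap.fst ℝ _ _) p)
    · exact isMorphismAt_smoothSpace_affineSpace (ContinuousLinearMap.snd ℝ _ _) p
  let p₀ : T := ⟨(z₀.1, 0), z₀.2⟩
  have hσ₀ : σ p₀ = y₀ := by
    change s (ρ z₀, 0) = y₀
    rw [hs0, hρz₀]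
  have hS : ∀ i, ∃ g : (Fin n → ℝ) × (Fin N → ℝ) → ℝ, ContDiffAt ℝ 1 g p₀ ∧
      ∀ᶠ p : T in 𝓝 p₀, χ (σ p) i = g p := fun i =>
    (hσ p₀).2 (fun y => χ y i) (hχreg _ (hσ₀ ▸ hy) i)
  choose g hg hgσ using hS
  let S : (Fin n → ℝ) × (Fin N → ℝ) → Fin n → ℝ := fun p i => g i p
  have hSd : HasStrictFDerivAt S (fderiv ℝ S p₀.1) (z₀.1, 0) :=
    (contDiffAt_pi.2 hg).hasStrictFDerivAt one_ne_zero
  have hB : ∀ᶠ p in 𝓝 ((z₀.1, 0) : (Fin n → ℝ) × (Fin N → ℝ)), ∀ h : p.1 ∈ Z,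
      σ ⟨p, h⟩ ∈ U ∧ χ (σ ⟨p, h⟩) = S p := by
    have h1 : ∀ᶠ p : T in 𝓝 p₀, σ p ∈ U := (hσ p₀).eventually_mem hU (hσ₀ ▸ hy)
    have h2 := h1.and (Filter.eventually_all.2 hgσ)
    rw [nhds_subtype_eq_comap, Filter.eventually_comap] at h2
    filter_upwards [h2] with p hp h
    have := hp ⟨p, h⟩ rfl
    exact ⟨this.1, funext this.2⟩
  -- domination in local coordinates
  have hPd : HasStrictFDerivAt (fun z i => MvPolynomial.eval z (P i))
      (ContinuousLinearMap.pi fun i => (P i).evalFDeriv z₀.1) z₀.1 :=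
    hasStrictFDerivAt_pi.2 fun i => (P i).hasStrictFDerivAt_eval z₀.1
  have hdom : ∀ w, (ContinuousLinearMap.pi fun i => (P i).evalFDeriv z₀.1) w = 0 →
      ∃ v, fderiv ℝ S p₀.1 (0, v) = w := by
    intro w hw
    obtain ⟨γ, hγ0, hγ, hγP⟩ :=
      hPd.exists_curve (MvPolynomial.surjective_evalFDeriv_pi hind) hw
    have hγZ : ∀ᶠ t in 𝓝 0, γ t ∈ Z := by
      have hc : Filter.Tendsto γ (𝓝 0) (𝓝 z₀) := hγ0 ▸ hγ.continuousAt
      filter_upwards [hγP, hc ((isOpen_of_isOpen_affineZariski hW).mem_nhds z₀.2.1)] with t h1 h2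
      exact ⟨h2, fun i => (congrFun h1 i).trans (z₀.2.2 i)⟩
    have hρs : IsMorphismAt (smoothSpace Z) (ringed (X := Y)) ρ z₀ :=
      IsMorphismAt.comp (hρmor z₀) (f := id) (IsMorphismAt.codRestrict
        (isMorphismAt_smoothSpace_affineSpace (ContinuousLinearMap.id ℝ _) z₀))
    obtain ⟨δ, hδ, hδw⟩ := exists_tangentVector_of_curve hρs hγ0 hγ hγZ
    have hsub' : IsSubmersionAtZero (fun w => s (y₀, w)) (ρ z₀) := by rwa [hρz₀]
    obtain ⟨v, hv⟩ := hsub'.2 δ hδ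
    refine ⟨v, ?_⟩
    have hline : Filter.Tendsto (fun t : ℝ => ((z₀.1, t • v) : (Fin n → ℝ) × (Fin N → ℝ)))
        (𝓝 0) (𝓝 (z₀.1, 0)) := by
      have : Continuous fun t : ℝ => ((z₀.1, t • v) : (Fin n → ℝ) × (Fin N → ℝ)) := by fun_prop
      simpa using this.tendsto 0
    have h1 : HasDerivAt (fun t : ℝ => S (z₀.1, t • v)) (fderiv ℝ S p₀.1 (0, v)) 0 := by
      have h2 : HasDerivAt (fun t : ℝ => ((z₀.1, t • v) : (Fin n → ℝ) × (Fin N → ℝ)))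
          (0, v) 0 := by
        have := (hasDerivAt_id (0 : ℝ)).smul_const v
        simp only [id, one_smul] at this
        exact (hasDerivAt_const (0 : ℝ) z₀.1).prodMk this
      have h3 : HasFDerivAt S (fderiv ℝ S p₀.1) (z₀.1, (0 : ℝ) • v) := by
        rw [zero_smul]; exact hSd.hasFDerivAt
      exact h3.comp_hasDerivAt (0 : ℝ) h2
    ext i
    have h4 := hv ⟨fun y => χ y i, hχreg _ (hρU z₀) i⟩
    rw [hδw _ i fun z => congrFun (hχρ z) i] at h4
    refine (hasDerivAt_pi.1 h1 i).unique (h4.congr_of_eventuallyEq ?_)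
    filter_upwards [hline.eventually hB] with t ht
    have h5 := congrFun (ht z₀.2).2 i
    simp only [σ] at h5
    rw [← h5]
    change χ (s (ρ z₀, t • v)) i = _
    rw [hρz₀]
  have hS0 : ∀ᶠ z in 𝓝 z₀.1, z ∈ Z → S (z, 0) = z := by
    have hc : Filter.Tendsto (fun z : Fin n → ℝ => ((z, 0) : (Fin n → ℝ) × (Fin N → ℝ)))
        (𝓝 z₀.1) (𝓝 (z₀.1, 0)) :=
      (Continuous.prodMk continuous_id continuous_const).tendsto _
    filter_upwards [hc.eventually hB] with z hz h
    rw [← (hz h).2]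
    change χ (s (ρ ⟨z, h⟩, 0)) = z
    rw [hs0, hχρ]
  have hSZ : ∀ᶠ p in 𝓝 ((z₀.1, 0) : (Fin n → ℝ) × (Fin N → ℝ)), p.1 ∈ Z → S p ∈ Z := by
    filter_upwards [hB] with p hp h
    rw [← (hp h).2]
    exact hχZ _ (hp h).1
  obtain ⟨O, hO, hz₀O, τ, hτc, hτ0, hτ⟩ := exists_local_section z₀.2 hPd
    (fun z hz => funext hz.2) hSd hS0 hSZ hdom hB
  refine ⟨U ∩ χ ⁻¹' O, Filter.inter_mem ((isOpen_of_zariski hU).mem_nhds hy) ?_,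
    fun p => τ (χ p.1, χ p.2), ?_, ?_, ?_⟩
  · have : ContinuousAt χ y₀ :=
      continuousAt_pi.2 fun i => continuousAt_of_mem_regularAt (hχreg y₀ hy i)
    exact this.preimage_mem_nhds (hO.mem_nhds (by rwa [hχy₀]))
  · have hχc : ContinuousOn χ (U ∩ χ ⁻¹' O) := fun y h =>
      (continuousAt_pi.2 fun i => continuousAt_of_mem_regularAt
        (hχreg y h.1 i)).continuousWithinAt
    refine hτc.comp (f := fun p : Y × Y => (χ p.1, χ p.2)) (hχc.prodMap hχc) ?_
    exact fun p hp => ⟨hp.1.2, hp.2.2⟩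
  · exact fun y h => hτ0 _ ⟨hχZ y h.1, h.2⟩
  · intro y h y' h'
    obtain ⟨h1, h2⟩ := hτ _ ⟨hχZ y h.1, h.2⟩ _ ⟨hχZ y' h'.1, h'.2⟩
    obtain ⟨h3, h4⟩ := h1 (hχZ y h.1)
    simp only [σ] at h3 h4
    rw [hρχ y h.1] at h3 h4
    exact hχinj _ h3 _ h'.1 (h4.trans h2)

/-! ### Fragmentation of homotopies -/

/-- The map `x ↦ H (x, l x)`. -/
def ContinuousMap.slice {K : Type u} {Y : Type v} [TopologicalSpace K] [TopologicalSpace Y]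
    (H : C(K × ℝ, Y)) (l : C(K, ℝ)) : C(K, Y) :=
  H.comp ((ContinuousMap.id K).prodMk l)

/-- A homotopy over a compact Hausdorff space `K` can be decomposed into finitely many moves, each
of which is supported in a closed set `C` and takes place in one of the given open sets of the
target: subdivide the time interval by the Lebesgue number lemma, and `K` by a partition of
unity. -/
theorem ContinuousMap.slice_one_mem_of_moves {K : Type u} {Y : Type v} [TopologicalSpace K]
    [CompactSpace K] [T2Space K] [TopologicalSpace Y] (H : C(K × ℝ, Y)) {𝒲 : Y → Set Y}
    (h𝒲 : ∀ y, 𝒲 y ∈ 𝓝 y) {R : Set C(K, Y)}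
    (hmove : ∀ (l l' : C(K, ℝ)) (C : Set K), IsClosed C → (∀ x ∉ C, l x = l' x) →
      (∃ y, ∀ x ∈ C, H (x, l x) ∈ 𝒲 y ∧ H (x, l' x) ∈ 𝒲 y) → H.slice l ∈ R → H.slice l' ∈ R)
    (h0 : H.slice 0 ∈ R) : H.slice 1 ∈ R := by
  classical
  let := uniformSpaceOfCompactR1 (γ := K)
  obtain ⟨E, hE, hEH⟩ := lebesgue_number_lemma_nhds (U := fun p => H ⁻¹' 𝒲 (H p))
    ((isCompact_univ (X := K)).prod (isCompact_Icc (a := (0 : ℝ)) (b := 1)))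
    fun p _ => H.continuous.continuousAt.preimage_mem_nhds (h𝒲 _)
  obtain ⟨E₁, hE₁, E₂, hE₂, hprod⟩ := entourageProd_subset hE
  obtain ⟨ε, hε, hεE⟩ := Metric.mem_uniformity_dist.1 hE₂
  obtain ⟨m, hm⟩ := exists_nat_one_div_lt hε
  obtain ⟨t, -, ht⟩ := (isCompact_univ (X := K)).elim_nhds_subcover
    (fun x => interior (UniformSpace.ball x E₁))
    fun x _ => interior_mem_nhds.2 (UniformSpace.ball_mem_nhds x hE₁)
  obtain ⟨ρ, hρ⟩ := PartitionOfUnity.exists_isSubordinate isClosed_univ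
    (fun x : t => interior (UniformSpace.ball x.1 E₁)) (fun _ => isOpen_interior)
    fun x hx => by
      obtain ⟨y, hy, hxy⟩ := Set.mem_iUnion₂.1 (ht hx)
      exact Set.mem_iUnion.2 ⟨⟨y, hy⟩, hxy⟩
  have hsum : ∀ x, ∑ a, ρ a x = 1 := fun x => by
    rw [← finsum_eq_sum_of_fintype]; exact ρ.sum_eq_one trivial
  have hpart : ∀ (S : Finset t) x, 0 ≤ ∑ a ∈ S, ρ a x ∧ ∑ a ∈ S, ρ a x ≤ 1 := fun S x =>
    ⟨Finset.sum_nonneg fun a _ => ρ.nonneg a x,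
      (Finset.sum_le_univ_sum_of_nonneg fun a => ρ.nonneg a x).trans (hsum x).le⟩
  set δ : ℝ := 1 / ((m : ℝ) + 1) with hδ
  have hδ0 : 0 < δ := by positivity
  let l : ℕ → Finset t → C(K, ℝ) := fun i S => ⟨fun x => i * δ + δ * ∑ a ∈ S, ρ a x, by fun_prop⟩
  have hl : ∀ i S x, l i S x = i * δ + δ * ∑ a ∈ S, ρ a x := fun _ _ _ => rfl
  have hstep : ∀ i ≤ m, H.slice (l i ∅) ∈ R → ∀ S, H.slice (l i S) ∈ R := by
    intro i hi hR S
    induction S using Finset.induction_on with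
    | empty => exact hR
    | insert a S ha ih =>
      refine hmove (l i S) (l i (insert a S)) (tsupport (ρ a)) (isClosed_tsupport _) ?_ ?_ ih
      · intro x hx
        simp [hl, Finset.sum_insert ha, image_eq_zero_of_notMem_tsupport hx]
      · have hi1 : (i : ℝ) * δ ∈ Set.Icc (0 : ℝ) 1 := by
          refine ⟨by positivity, ?_⟩
          rw [hδ, mul_one_div, div_le_one (by positivity)]
          exact_mod_cast hi.trans (Nat.le_succ m)
        obtain ⟨p, hp⟩ := hEH (a.1, i * δ) ⟨trivial, hi1⟩
        have key : ∀ x ∈ tsupport (ρ a), ∀ S, H (x, l i S x) ∈ 𝒲 (H p) := by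
          intro x hx S
          have hb : x ∈ UniformSpace.ball a.1 E₁ := interior_subset (hρ a hx)
          refine hp (hprod ⟨hb, hεE ?_⟩)
          rw [hl, Real.dist_eq, abs_sub_comm, add_sub_cancel_left,
            abs_of_nonneg (mul_nonneg hδ0.le (hpart S x).1)]
          exact (mul_le_of_le_one_right hδ0.le (hpart S x).2).trans_lt hm
        exact ⟨H p, fun x hx => ⟨key x hx S, key x hx _⟩⟩
  have hall : ∀ i ≤ m + 1, H.slice (l i ∅) ∈ R := by
    intro i
    induction i with
    | zero =>
      intro _
      convert h0 using 2
      ext x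
      simp [hl]
    | succ i ih =>
      intro hi
      have := hstep i (by omega) (ih (by omega)) Finset.univ
      convert this using 2
      ext x
      rw [hl, hl, hsum, Finset.sum_empty]
      push_cast
      ring
  convert hall (m + 1) le_rfl using 2
  ext x
  have : ((m : ℝ) + 1) ≠ 0 := by positivity
  simp [hl, hδ, this]

/-! ### Approximation by regular maps -/

theorem isMorphismAt_of_continuous {S : Type u} {T : Type v} [TopologicalSpace S]
    [TopologicalSpace T] {f : S → T} (hf : Continuous f) (x : S) :
    IsMorphismAt (continuousSpace S) (continuousSpace T) f x := by
  refine ⟨hf.tendsto x, fun φ hφ => ?_⟩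
  have hφ' : ∀ᶠ z in 𝓝 (f x), ContinuousAt φ z := hφ
  change ∀ᶠ z in 𝓝 x, ContinuousAt (φ ∘ f) z
  filter_upwards [(hf.tendsto x).eventually hφ'] with z hz using hz.comp hf.continuousAt

theorem continuous_of_isMorphism_prod_affineSpace {Y : Type v} [RealAlgebraicVariety Y] {N : ℕ}
    {s : Y × (Fin N → ℝ) → Y}
    (hs : IsMorphism ((ringed (X := Y)).prod (affineSpace N)) (ringed (X := Y)) s) :
    Continuous s := by
  refine continuous_of_isMorphismAt fun p => IsMorphismAt.comp (hs.isMorphismAt p)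
    (f := id) (IsMorphismAt.prodMk (isLocal_continuousSpace _) ?_ ?_)
  · exact (isMorphismAt_continuousSpace _).comp (isMorphismAt_of_continuous continuous_fst p)
  · refine isMorphismAt_affineSpace (isLocal_continuousSpace _) fun i => ?_
    have : Continuous fun z : Y × (Fin N → ℝ) => z.2 i := by fun_prop
    exact Filter.Eventually.of_forall fun z => this.continuousAt

section

variable {X : Type u} {Y : Type v} [RealAlgebraicVariety X] [RealAlgebraicVariety Y]

/-- The continuous maps on `K` which are approximable by regular maps `X → Y` that coincide with
`f₀` on `A`. -/
def approximable {K : Type w} [TopologicalSpace K] (ι : C(K, X)) (A : Set X) (f₀ : RegularMap X Y) :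
    Set C(K, Y) :=
  closure {h | ∃ g : RegularMap X Y, (∀ x ∈ A, g x = f₀ x) ∧ ∀ k, h k = g (ι k)}

/-- If `h` is approximable, then so is `s (h, η)` for every continuous `η` which vanishes on `A`:
approximate `h` by regular maps and `η` by regular functions vanishing on `A`. -/
theorem spray_mem_approximable {K : Type w} [TopologicalSpace K] [CompactSpace K] {ι : C(K, X)}
    (hι : Function.Injective ι) {A : Set X} (hA : IsZariskiClosed A) {f₀ : RegularMap X Y}
    {N : ℕ} {s : Y × (Fin N → ℝ) → Y}
    (hs : IsMorphism ((ringed (X := Y)).prod (affineSpace N)) (ringed (X := Y)) s)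
    (hs0 : ∀ y, s (y, 0) = y) {h h' : C(K, Y)} (hh : h ∈ approximable ι A f₀)
    {η : Fin N → C(K, ℝ)} (hη : ∀ i k, ι k ∈ A → η i k = 0)
    (hh' : ∀ k, h' k = s (h k, fun i => η i k)) : h' ∈ approximable ι A f₀ := by
  have : T2Space X := t2Space_variety X
  have : T2Space K := T2Space.of_injective_continuous hι ι.continuous
  have hsc := continuous_of_isMorphism_prod_affineSpace hs
  let Ξ : C(K, Y) → (Fin N → C(K, ℝ)) → C(K, Y) := fun h η =>
    ⟨fun k => s (h k, fun i => η i k), by fun_prop⟩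
  have hΞ : Continuous (Function.uncurry Ξ) := by
    refine ContinuousMap.continuous_of_continuous_uncurry _ ?_
    change Continuous fun p : (C(K, Y) × (Fin N → C(K, ℝ))) × K =>
      s (p.1.1 p.2, fun i => p.1.2 i p.2)
    fun_prop
  have hη' : η ∈ closure (Set.univ.pi fun _ : Fin N =>
      pullbackRegular ι '' {φ | ∀ x ∈ A, φ.1 x = 0}) := by
    rw [closure_pi_set]
    exact fun i _ => mem_closure_regular_vanishing hι hA (hη i)
  have heq : h' = Ξ h η := ContinuousMap.ext hh'
  rw [heq]
  refine map_mem_closure₂ hΞ hh hη' ?_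
  rintro a ⟨g, hgA, hg⟩ b hb
  choose β hβA hβ using fun i => hb i trivial
  refine ⟨⟨fun x => s (g x, fun i => (β i).1 x), isMorphism_iff.2 fun x => ?_⟩, ?_, ?_⟩
  · refine IsMorphismAt.comp (hs.isMorphismAt _) (f := fun x => (g x, fun i => (β i).1 x))
      (IsMorphismAt.prodMk (isLocal_ringed X) (g.isMorphism.isMorphismAt x) ?_)
    exact isMorphismAt_affineSpace (isLocal_ringed X) fun i => mem_globalRegular.1 (β i).2 x
  · intro x hx
    have : (fun i => (β i).1 x) = 0 := funext fun i => hβA i x hx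
    change s (g x, fun i => (β i).1 x) = f₀ x
    rw [this, hs0, hgA x hx]
  · intro k
    change s (a k, fun i => b i k) = s (g (ι k), fun i => (β i).1 (ι k))
    rw [hg k]
    congr 2
    ext i
    rw [← hβ i]
    rfl

/-- The end of a homotopy relative to `A`, over a compact space, which starts at a regular map
`f₀` is approximable. -/
theorem slice_one_mem_approximable (hY : IsNonsingular Y) (hmal : IsMalleable Y) {K : Type w}
    [TopologicalSpace K] [CompactSpace K] {ι : C(K, X)} (hι : Function.Injective ι) {A : Set X}
    (hA : IsZariskiClosed A) {f₀ : RegularMap X Y} {H : C(K × ℝ, Y)}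
    (H0 : ∀ k, H (k, 0) = f₀ (ι k)) (HA : ∀ k t, ι k ∈ A → H (k, t) = f₀ (ι k)) :
    H.slice 1 ∈ approximable ι A f₀ := by
  classical
  have : T2Space X := t2Space_variety X
  have : T2Space Y := t2Space_variety Y
  have : T2Space K := T2Space.of_injective_continuous hι ι.continuous
  obtain ⟨N, s, hs, hs0, hdom⟩ := exists_spray_product hmal
  choose 𝒲 h𝒲 τ hτc hτ0 hτ using fun y => exists_local_inverse_spray (hY y) hs hs0 (hdom y)
  refine H.slice_one_mem_of_moves h𝒲 ?_ (subset_closure ⟨f₀, fun _ _ => rfl, H0⟩)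
  rintro l l' C hC hll' ⟨y, hy⟩ hl
  let q : K → Y × Y := fun k => (H (k, l k), H (k, l' k))
  have hq : Continuous q := by fun_prop
  -- the move is `s (h, η)`, where `η` is the local solution on `C` and zero elsewhere
  let η : K → Fin N → ℝ := C.piecewise (fun k => τ y (q k)) 0
  have hηc : Continuous η := by
    refine continuous_piecewise (fun k hk => ?_) ?_ continuousOn_const
    · have hkC : k ∈ C := hC.frontier_subset hk
      have heq : ∀ k ∈ closure Cᶜ, l k = l' k := fun k hk =>
        closure_minimal (s := Cᶜ) (t := {k | l k = l' k}) hll'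
          (isClosed_eq l.continuous l'.continuous) hk
      have hk' : k ∈ closure Cᶜ := frontier_subset_closure (frontier_compl C ▸ hk)
      simp only [q, ← heq k hk']
      exact hτ0 y _ (hy k hkC).1
    · rw [hC.closure_eq]
      exact (hτc y).comp hq.continuousOn fun k hk => hy k hk
  refine spray_mem_approximable hι hA hs hs0 hl
    (η := fun i => ⟨fun k => η k i, (continuous_apply i).comp hηc⟩) (fun i k hk => ?_) fun k => ?_
  · change η k i = 0
    by_cases hkC : k ∈ C
    · have h1 : q k = (H (k, l k), H (k, l k)) := by simp [q, HA k _ hk]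
      simp only [η, Set.piecewise_eq_of_mem _ _ _ hkC, h1, hτ0 y _ (hy k hkC).1]
      rfl
    · simp [η, hkC]
  · change H (k, l' k) = s (H (k, l k), η k)
    by_cases hkC : k ∈ C
    · simp only [η, Set.piecewise_eq_of_mem _ _ _ hkC]
      exact (hτ y _ (hy k hkC).1 _ (hy k hkC).2).symm
    · rw [← hll' k hkC]
      simp only [η, Set.piecewise_eq_of_notMem _ _ _ hkC]
      exact (hs0 _).symm

end

/-- In the compact-open topology, approximation on every compact subset is approximation. -/
theorem ContinuousMap.mem_closure_of_restrict {D : Type u} {Y : Type v} [TopologicalSpace D]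
    [TopologicalSpace Y] {f : C(D, Y)} {S : Set C(D, Y)}
    (h : ∀ K : Set D, IsCompact K →
      f.restrict K ∈ closure ((fun g : C(D, Y) => g.restrict K) '' S)) : f ∈ closure S := by
  refine mem_closure_iff_nhds.2 fun 𝒰 h𝒰 => ?_
  rw [ContinuousMap.nhds_compactOpen_eq_iInf_nhds_induced] at h𝒰
  have hmono : ∀ {K K' : Set D}, K ⊆ K' →
      (𝓝 (f.restrict K')).comap (ContinuousMap.restrict K') ≤
        (𝓝 (f.restrict K)).comap (ContinuousMap.restrict K) := by
    intro K K' hKK'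
    let r : C(K', Y) → C(K, Y) := fun g => g.comp ⟨Set.inclusion hKK', continuous_inclusion hKK'⟩
    have hr : Continuous r := ContinuousMap.continuous_precomp _
    rw [← Filter.tendsto_iff_comap]
    exact (hr.tendsto (f.restrict K')).comp Filter.tendsto_comap
  obtain ⟨K, hK, 𝒱, h𝒱, hsub⟩ := (Filter.mem_biInf_of_directed (s := {K : Set D | IsCompact K})
    (f := fun K => (𝓝 (f.restrict K)).comap (ContinuousMap.restrict K))
    (fun K hK K' hK' => ⟨K ∪ K', IsCompact.union hK hK', hmono Set.subset_union_left,
      hmono Set.subset_union_right⟩) ⟨∅, isCompact_empty⟩).1 h𝒰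
  obtain ⟨_, h1, g, hg, rfl⟩ := mem_closure_iff_nhds.1 (h K hK) 𝒱 h𝒱
  exact ⟨g, hsub h1, hg⟩

theorem theorem1p14 {X : Type u} {Y : Type v} [RealAlgebraicVariety X] [RealAlgebraicVariety Y]
    (hY : IsNonsingular Y) (hmal : IsMalleable Y)
    (D : Set X) (f : C(D, Y)) (A : Set X) (hA : IsZariskiClosed A) (f₀ : RegularMap X Y)
    (hagree : ∀ x : D, (x : X) ∈ A → f₀ x = f x)
    (hhom : (f₀.restrict D).HomotopicRel f {x : D | (x : X) ∈ A}) :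
    ∀ 𝒰 : Set C(D, Y), IsOpen 𝒰 → f ∈ 𝒰 →
      ∃ g : RegularMap X Y, g.restrict D ∈ 𝒰 ∧ ∀ x ∈ A, g x = f₀ x := by
  obtain ⟨F⟩ := hhom
  have key : f ∈ closure {h : C(D, Y) | ∃ g : RegularMap X Y,
      (∀ x ∈ A, g x = f₀ x) ∧ h = g.restrict D} := by
    refine ContinuousMap.mem_closure_of_restrict fun K hK => ?_
    have : CompactSpace K := isCompact_iff_compactSpace.1 hK
    let ι : C(K, X) := ⟨fun k => k.1.1, by fun_prop⟩
    have hι : Function.Injective ι := fun a b hab => Subtype.ext (Subtype.ext hab)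
    -- the homotopy over `K`, extended to the time interval `ℝ`
    let H : C(K × ℝ, Y) := ⟨fun p => F (Set.projIcc 0 1 zero_le_one p.2, p.1.1), by fun_prop⟩
    have h1 : H.slice 1 ∈ approximable ι A f₀ := by
      refine slice_one_mem_approximable hY hmal hι hA (fun k => ?_) fun k t hk => ?_
      · change F (Set.projIcc 0 1 zero_le_one 0, k.1) = f₀ k.1
        rw [Set.projIcc_left]
        exact F.apply_zero k.1
      · exact F.eq_fst _ hk
    have h2 : H.slice 1 = f.restrict K := by
      ext k
      change F (Set.projIcc 0 1 zero_le_one 1, k.1) = f k.1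
      rw [Set.projIcc_right]
      exact F.apply_one k.1
    rw [h2] at h1
    refine closure_mono ?_ h1
    rintro h ⟨g, hgA, hg⟩
    exact ⟨g.restrict D, ⟨g, hgA, rfl⟩, ContinuousMap.ext fun k => (hg k).symm⟩
  intro 𝒰 h𝒰 hf
  obtain ⟨_, h1, g, hgA, rfl⟩ := mem_closure_iff.1 key 𝒰 h𝒰 hf
  exact ⟨g, h1, hgA⟩
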